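/- Diagrams are finite sets of boxes, considered up to translation. For partitions $\kappa\subseteq\rho$ (the empty partition is allowed), $\rho/\kappa$ is the skew diagram of the boxes of $\rho$ that are not in $\kappa$. The skew Schur function of a skew diagram $D$ is $s_D=\sum_T x_1^{\#1\text{'s in }T}x_2^{\#2\text{'s in }T}\cdots$, the sum being over all semistandard Young tableaux $T$ of shape $D$; $s_\nu$ is the case $D=\nu$ of a partition. The Littlewood–Richardson coefficients $c^{\rho}_{\kappa\nu}$ are given by $s_{\rho/\kappa}=\sum_\nu c^{\rho}_{\kappa\nu}s_\nu$. A symmetric function is Schur-positive if it is a linear combination of Schur functions with nonnegative coefficients. For a composition $\alpha=(\alpha_1,\dots,\alpha_n)$ (a finite, possibly empty, sequence of positive integers) let $\delta_\alpha$ be the partition $(n^{\alpha_n},(n-1)^{\alpha_{n-1}},\dots,1^{\alpha_1})$, which has exactly $\alpha_i$ parts equal to $i$, and let $\Delta_\alpha$ be the diagram $\delta_\alpha$ rotated by $180^\circ$. A partition $\nu$ is a fat staircase if $\nu=\delta_\alpha$ for some composition $\alpha$; this $\alpha$ is then denoted by $\alpha(\nu)$. Let $D$ be a skew diagram, let $\mu\subseteq\lambda$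 be partitions, and let $k\ge 0$ be an integer such that $\lambda_1-\mu_1-k$ is at most the length of the last row of $D$. Then $\mathcal S(\lambda,\mu,D;k)$ is the diagram obtained by placing $\lambda/\mu$ immediately below $D$ so that the first row of $\lambda/\mu$ begins one row below, and $k$ columns to the left of, the bottom-left box of $D$. (When $D$ is empty, its last row is taken to have length $0$, and $\mathcal S(\lambda,\mu,D;k)=\lambda/\mu$.) Write $\mathcal S(\lambda,\mu,\alpha^{\triangleleft};k)=\mathcal S(\lambda,\mu,\Delta_\alpha;k)$. **Theorem.** Let $D=\rho/\kappa$ be a sum of fat staircases, that is, $$s_D=\sum_{\nu\ \text{fat staircase}}c^{\rho}_{\kappa\nu}\,s_\nu ,$$ so that $c^{\rho}_{\kappa\nu}=0$ for every $\nu$ that is not a fat staircase. Then for all partitions $\mu\subseteq\lambda$ and every integer $k\ge 0$ such that $\lambda_1-\mu_1-k$ is at most the length of the last row of $D$, the difference $$\sum_{\nu}c^{\rho}_{\kappa\nu}\,s_{\mathcal S(\lambda,\mu,\alpha(\nu)^{\triangleleft};k)}-s_{\mathcal S(\lambda,\mu,D;k)}$$ is Schur-positive. -/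

import Mathlib

noncomputable section

namespace FatStaircase

/-- A diagram: a finite set of boxes `(i, j)`, where `i` is the row (rows are numbered downwards)
and `j` is the column (columns are numbered from left to right). Diagrams are considered up to
translation; everything below is translation invariant. -/
abbrev Diagram := Finset (ℤ × ℤ)

/-- The skew diagram `lam / mu`. -/
def skewDiagram (lam mu : YoungDiagram) : Diagram :=
  (lam.cells \ mu.cells).image fun c => ((c.1 : ℤ), (c.2 : ℤ))

/-- The rotation of a diagram by 180 degrees. -/
def rotate (D : Diagram) : Diagram :=
  D.image fun c => (-c.1, -c.2)

/-- A filling of a diagram by natural numbers is semistandard if its rows weakly increase from left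
to right and its columns strictly increase downwards. As for `SemistandardYoungTableau` in Mathlib,
the entries are counted from `0`: the entry `i` here is the positive integer `i + 1`. -/
def IsSemistandard (D : Diagram) (T : D → ℕ) : Prop :=
  (∀ x y : D, x.1.1 = y.1.1 → x.1.2 < y.1.2 → T x ≤ T y) ∧
  (∀ x y : D, x.1.2 = y.1.2 → x.1.1 < y.1.1 → T x < T y)

/-- The content of a filling: how many times each entry occurs. -/
def content {D : Diagram} (T : D → ℕ) : ℕ →₀ ℕ :=
  ∑ x : D, Finsupp.single (T x) 1

/-- The skew Schur function `s_D`, a formal power series in infinitely many variables. The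
coefficient of the monomial with exponents `d` is the number of semistandard tableaux of shape `D`
and content `d` (there are finitely many, as all their entries lie in the support of `d`). -/
def skewSchur (D : Diagram) : MvPowerSeries ℕ ℤ :=
  fun d => (Nat.card {T : D → ℕ // IsSemistandard D T ∧ content T = d} : ℤ)

/-- The Schur function `s_ν` of a partition `ν`. -/
def schur (ν : YoungDiagram) : MvPowerSeries ℕ ℤ :=
  skewSchur (skewDiagram ν ⊥)

/-- `f = ∑ a_ν s_ν`, a finite integral linear combination of Schur functions. -/
def HasSchurExpansion (f : MvPowerSeries ℕ ℤ) (a : YoungDiagram →₀ ℤ) : Prop :=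
  f = ∑ ν ∈ a.support, a ν • schur ν

open Classical in
/-- The coefficients `[s_ν] f` of the expansion of a symmetric function `f` in Schur functions
(zero if `f` has no such expansion; the Schur functions are linearly independent, so there is at
most one). -/
def schurCoeff (f : MvPowerSeries ℕ ℤ) : YoungDiagram →₀ ℤ :=
  if h : ∃ a, HasSchurExpansion f a then h.choose else 0

/-- Schur-positivity: `f` is a linear combination of Schur functions with nonnegative
coefficients. -/
def SchurPositive (f : MvPowerSeries ℕ ℤ) : Prop :=
  ∃ a : YoungDiagram →₀ ℤ, HasSchurExpansion f a ∧ ∀ ν, 0 ≤ a ν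

/-- The Littlewood-Richardson coefficients `c^ρ_{κ ν}`, as a function of `ν`: the coefficients of
`s_{ρ / κ}` in the basis of Schur functions. -/
def lrCoeff (ρ κ : YoungDiagram) : YoungDiagram →₀ ℤ :=
  schurCoeff (skewSchur (skewDiagram ρ κ))

/-- For `α = (α_1, …, α_n)`, the sequence `(n^{α_n}, (n-1)^{α_{n-1}}, …, 1^{α_1})`. -/
def deltaRows (α : List ℕ) : List ℕ :=
  (List.range α.length).reverse.flatMap fun i => List.replicate (α.getD i 0) (i + 1)

theorem deltaRows_sorted (α : List ℕ) : (deltaRows α).SortedGE := by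
  rw [List.sortedGE_iff_pairwise]
  unfold deltaRows
  rw [List.pairwise_flatMap]
  refine ⟨fun i _ => by simp [List.pairwise_replicate], ?_⟩
  rw [List.pairwise_reverse]
  refine List.Pairwise.imp ?_ List.pairwise_lt_range
  intro a b hab x hx y hy
  have h1 := List.eq_of_mem_replicate hx
  have h2 := List.eq_of_mem_replicate hy
  omega

/-- The partition `δ_α = (n^{α_n}, …, 2^{α_2}, 1^{α_1})`. -/
def delta (α : List ℕ) : YoungDiagram :=
  YoungDiagram.ofRowLens (deltaRows α) (deltaRows_sorted α)

/-- The diagram `Δ_α`, the rotation of `δ_α` by 180 degrees. -/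
def Delta (α : List ℕ) : Diagram :=
  rotate (skewDiagram (delta α) ⊥)

/-- The partition `ν` is a fat staircase: `ν = δ_α` for a composition `α`, a finite sequence of
positive integers. (A partition of the form `Δ_α` is a single column, so also of the form `δ_α`.) -/
def IsFatStaircase (ν : YoungDiagram) : Prop :=
  ∃ α : List ℕ, (∀ a ∈ α, 0 < a) ∧ ν = delta α

/-- The sequence `α(ν)`, of length `ν_1`, whose `i`-th entry is the number of parts of `ν` that are
equal to `i`. If `ν` is a fat staircase, it is the composition with `δ_{α(ν)} = ν`. -/
def alphaOf (ν : YoungDiagram) : List ℕ :=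
  (List.range (ν.rowLen 0)).map fun i => ν.rowLens.count (i + 1)

open Classical in
/-- The diagram `ρ / κ` is a sum of fat staircases:
`s_{ρ / κ} = ∑ c^ρ_{κ ν} s_ν`, where the sum is over the fat staircases `ν`. -/
def IsSumOfFatStaircases (ρ κ : YoungDiagram) : Prop :=
  skewSchur (skewDiagram ρ κ) =
    ∑ ν ∈ (lrCoeff ρ κ).support with IsFatStaircase ν, lrCoeff ρ κ ν • schur ν

/-- The position of the last (lowest) row of a diagram (`0` for the empty diagram). -/
def lastRow (D : Diagram) : ℤ :=
  (D.image Prod.fst).max.unbotD 0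

/-- The boxes in the last row of a diagram. -/
def lastRowBoxes (D : Diagram) : Diagram :=
  D.filter fun c => c.1 = lastRow D

/-- The column of the bottom-left box of a diagram (`0` for the empty diagram). -/
def lastRowStart (D : Diagram) : ℤ :=
  ((lastRowBoxes D).image Prod.snd).min.untopD 0

/-- The diagram `S(lam, mu, D; k)`: the skew diagram `lam / mu` is placed immediately below `D`
so that its first row begins one row below, and `k` columns to the left of, the bottom-left box
of `D`. (The first row of `lam / mu` begins in column `mu_1`, when columns are counted from `0`.) -/
def glue (lam mu : YoungDiagram) (D : Diagram) (k : ℕ) : Diagram :=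
  D ∪ (skewDiagram lam mu).image fun c =>
    (lastRow D + 1 + c.1, lastRowStart D - k + (c.2 - mu.rowLen 0))

end FatStaircase

end

/-! By the Littlewood–Richardson rule, the coefficient of `s_σ` in a skew Schur function is the
number of semistandard lattice fillings of content `σ`. Both sides of the difference thus count
fillings, and an injection suffices.

A lattice filling of `S(λ,μ,D;k)` restricts to a lattice filling `T` of `D`, say of content `ν`, and
the number of such `T` is `c^ρ_{κν}`. The part on `λ/μ` meets the upper part in two ways only: the
lattice condition sees just the content `ν`, and column-strictness sees the boxes of `D` in the
common columns, hence just the last row of `D`. Now `T` is replaced by the filling of the rotated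
diagram of `ν` whose columns read `0, 1, 2, …` downwards. It is lattice of content `ν`, and when
last rows are aligned on the left its entries are at most those of `T`: if the box in position `t`
(from 0) of the last row of `D` has entry `a`, then `ν_{a+1} + t + 1 ≤ ν_0` with rows numbered from
0 (`HasFoot.cnt_succ_add_le`), so the corresponding column of `ν` has height at most `a + 1`. The
result is therefore again a lattice filling (`replaceTop_mem`). For fixed `T` nothing is lost
(`card_le_card_glue`), and summing over `T` gives the inequality.

The Littlewood–Richardson rule (`skewSchur_eq_sum`) is proved here as well. A Bender–Knuth flip
after the first violation of the lattice condition cancels the other fillings in an alternating sum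
of monomial coefficients (`sum_sign_shifted`); these alternating sums determine a symmetric function
(`coeffAt_eq_zero`) and are dual to the Schur functions (`signedCoeff_schur`). -/

noncomputable section
namespace FatStaircase
open Finset

/-! ### Fillings of convex diagrams and the Bender–Knuth flip. -/

/-- Semistandardness on `D` of a filling of the whole plane. -/
def Semi (D : Diagram) (F : ℤ × ℤ → ℕ) : Prop :=
  (∀ x ∈ D, ∀ y ∈ D, x.1 = y.1 → x.2 < y.2 → F x ≤ F y) ∧
  (∀ x ∈ D, ∀ y ∈ D, x.2 = y.2 → x.1 < y.1 → F x < F y)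

/-- The number of boxes of `D` with entry `b`. -/
def cnt (D : Diagram) (F : ℤ × ℤ → ℕ) (b : ℕ) : ℕ := #{x ∈ D | F x = b}

/-- The diagram contains each rectangle spanned by two of its boxes. -/
def Convex (D : Diagram) : Prop :=
  ∀ x ∈ D, ∀ y ∈ D, ∀ i j, x.1 ≤ i → i ≤ y.1 → x.2 ≤ j → j ≤ y.2 → (i, j) ∈ D

theorem Semi.congr {D : Diagram} {F G : ℤ × ℤ → ℕ} (h : Semi D F) (e : ∀ x ∈ D, F x = G x) :
    Semi D G := by
  refine ⟨fun x hx y hy => ?_, fun x hx y hy => ?_⟩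
  · rw [← e x hx, ← e y hy]; exact h.1 x hx y hy
  · rw [← e x hx, ← e y hy]; exact h.2 x hx y hy

theorem cnt_congr {D : Diagram} {F G : ℤ × ℤ → ℕ} (e : ∀ x ∈ D, F x = G x) (b : ℕ) :
    cnt D F b = cnt D G b := by
  unfold cnt
  congr 1
  exact filter_congr fun x hx => by rw [e x hx]

theorem Semi.mono {D E : Diagram} {F : ℤ × ℤ → ℕ} (h : Semi D F) (hE : E ⊆ D) : Semi E F :=
  ⟨fun x hx y hy => h.1 x (hE hx) y (hE hy), fun x hx y hy => h.2 x (hE hx) y (hE hy)⟩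

theorem cnt_mono {D E : Diagram} (h : D ⊆ E) (F : ℤ × ℤ → ℕ) (b : ℕ) : cnt D F b ≤ cnt E F b :=
  card_le_card (filter_subset_filter _ h)

theorem cnt_union {D E : Diagram} (h : Disjoint D E) (F : ℤ × ℤ → ℕ) (b : ℕ) :
    cnt (D ∪ E) F b = cnt D F b + cnt E F b := by
  unfold cnt
  rw [filter_union, card_union_of_disjoint (disjoint_filter_filter h)]

theorem cnt_filter_add (D : Diagram) (p : ℤ × ℤ → Prop) [DecidablePred p] (F : ℤ × ℤ → ℕ)
    (b : ℕ) : cnt {x ∈ D | p x} F b + cnt {x ∈ D | ¬ p x} F b = cnt D F b := by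
  rw [← cnt_union (disjoint_filter_filter_not D D p), filter_union_filter_not_eq]

theorem Semi.le {D : Diagram} {F : ℤ × ℤ → ℕ} (h : Semi D F) (hD : Convex D) {x y : ℤ × ℤ}
    (hx : x ∈ D) (hy : y ∈ D) (h1 : x.1 ≤ y.1) (h2 : x.2 ≤ y.2) : F x ≤ F y := by
  have hz : (x.1, y.2) ∈ D := hD x hx y hy _ _ le_rfl h1 h2 le_rfl
  have a : F x ≤ F (x.1, y.2) := by
    rcases h2.eq_or_lt with e | l
    · rw [← e]
    · exact h.1 x hx _ hz rfl l
  have b : F (x.1, y.2) ≤ F y := by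
    rcases h1.eq_or_lt with e | l
    · rw [e]
    · exact (h.2 _ hz _ hy rfl l).le
  exact a.trans b

/-- A box of `Z` with no neighbours in its column. -/
def Free (Z : Diagram) (x : ℤ × ℤ) : Prop :=
  x ∈ Z ∧ (x.1 + 1, x.2) ∉ Z ∧ (x.1 - 1, x.2) ∉ Z

/-- A lower neighbour of the middle box would force one below the left end, and an upper neighbour
would force one above the right end. So the free boxes of a row form an interval, which a reflection
can preserve. -/
theorem Convex.free_between {Z : Diagram} (hZ : Convex Z) {r j₁ j j₂ : ℤ} (h₁ : Free Z (r, j₁))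
    (h₂ : Free Z (r, j₂)) (hj₁ : j₁ ≤ j) (hj₂ : j ≤ j₂) : Free Z (r, j) := by
  refine ⟨hZ _ h₁.1 _ h₂.1 _ _ le_rfl le_rfl hj₁ hj₂, fun h => h₁.2.1 ?_, fun h => h₂.2.2 ?_⟩
  · exact hZ _ h₁.1 _ h _ _ (by simp) le_rfl le_rfl hj₁
  · exact hZ _ h _ h₂.1 _ _ le_rfl (by simp) hj₂ le_rfl

open Classical in
theorem Convex.exists_reflection {Z : Diagram} (hZ : Convex Z) (r : ℤ) :
    ∃ s : ℤ, ∀ j, Free Z (r, j) → Free Z (r, s - j) := by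
  set S : Finset ℤ := (Z.filter fun x => Free Z x ∧ x.1 = r).image Prod.snd with hS
  have mem : ∀ j, j ∈ S ↔ Free Z (r, j) := by
    intro j
    simp only [hS, mem_image, mem_filter, Prod.exists, exists_eq_right]
    exact ⟨fun ⟨a, _, h, e⟩ => e ▸ h, fun h => ⟨r, h.1, h, rfl⟩⟩
  rcases S.eq_empty_or_nonempty with h | h
  · exact ⟨0, fun j hj => by simp [← mem, h] at hj⟩
  · refine ⟨S.min' h + S.max' h, fun j hj => ?_⟩
    rw [← mem] at hj
    have h1 := S.min'_le j hj
    have h2 := S.le_max' j hj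
    exact hZ.free_between ((mem _).1 (S.min'_mem h)) ((mem _).1 (S.max'_mem h))
      (by omega) (by omega)

open Classical in
/-- Twice the centre of the free boxes in a row of `Z`. -/
def freeSum (Z : Diagram) (r : ℤ) : ℤ :=
  if h : ∃ s : ℤ, ∀ j, Free Z (r, j) → Free Z (r, s - j) then h.choose else 0

/-- The reflection of a row of `Z` that preserves the free boxes of this row. -/
def reflectFree (Z : Diagram) (x : ℤ × ℤ) : ℤ × ℤ :=
  (x.1, freeSum Z x.1 - x.2)

theorem reflectFree_reflectFree (Z : Diagram) (x : ℤ × ℤ) :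
    reflectFree Z (reflectFree Z x) = x := by
  simp [reflectFree]

theorem reflectFree_anti (Z : Diagram) {x y : ℤ × ℤ} (h : x.1 = y.1) (h2 : x.2 < y.2) :
    (reflectFree Z y).1 = (reflectFree Z x).1 ∧ (reflectFree Z y).2 < (reflectFree Z x).2 := by
  obtain ⟨x1, x2⟩ := x
  obtain ⟨y1, y2⟩ := y
  simp only at h h2
  subst h
  exact ⟨rfl, by simp only [reflectFree]; omega⟩

theorem Convex.free_reflectFree {Z : Diagram} (hZ : Convex Z) {x : ℤ × ℤ} (h : Free Z x) :
    Free Z (reflectFree Z x) := by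
  have e := hZ.exists_reflection x.1
  simp only [reflectFree, freeSum, dif_pos e]
  exact e.choose_spec x.2 h

open Classical in
/-- The Bender-Knuth involution on a filling of `Z` by `a` and `a + 1`. -/
def flip (Z : Diagram) (a : ℕ) (F : ℤ × ℤ → ℕ) (x : ℤ × ℤ) : ℕ :=
  if Free Z x then (if F (reflectFree Z x) = a then a + 1 else a) else F x

section flip
variable {Z : Diagram} {a : ℕ} {F : ℤ × ℤ → ℕ}

theorem flip_of_not_mem {x : ℤ × ℤ} (h : x ∉ Z) : flip Z a F x = F x :=
  if_neg fun h' => h h'.1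

theorem flip_mem (hF : ∀ x ∈ Z, F x = a ∨ F x = a + 1) {x : ℤ × ℤ} (h : x ∈ Z) :
    flip Z a F x = a ∨ flip Z a F x = a + 1 := by
  unfold flip
  split_ifs
  · exact .inr rfl
  · exact .inl rfl
  · exact hF x h

theorem flip_flip (hZ : Convex Z) (hF : ∀ x ∈ Z, F x = a ∨ F x = a + 1) :
    flip Z a (flip Z a F) = F := by
  funext x
  by_cases h : Free Z x
  · have h' := hZ.free_reflectFree h
    have := hF x h.1
    unfold flip
    rw [if_pos h, if_pos h', reflectFree_reflectFree]
    rcases this with e | e <;> simp [e]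
  · unfold flip
    rw [if_neg h, if_neg h]

/-- On the free interval of a row, the reflection and the exchange of letters both reverse the
order, so the row stays increasing. By convexity, a non-free box to the right of a free one has an
upper neighbour, hence the entry `a + 1`; one to the left has a lower neighbour, hence the entry
`a`. Boxes with a column neighbour do not change. -/
theorem Semi.flip (hZ : Convex Z) (hF : ∀ x ∈ Z, F x = a ∨ F x = a + 1) (h : Semi Z F) :
    Semi Z (flip Z a F) := by
  constructor
  · intro x hx y hy h1 h2
    by_cases fx : Free Z x <;> by_cases fy : Free Z y
    · have r := reflectFree_anti Z h1 h2
      have := h.1 _ (hZ.free_reflectFree fy).1 _ (hZ.free_reflectFree fx).1 r.1 r.2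
      have e1 := hF _ (hZ.free_reflectFree fy).1
      have e2 := hF _ (hZ.free_reflectFree fx).1
      simp only [FatStaircase.flip, if_pos fx, if_pos fy]
      split_ifs <;> omega
    · have e : F y = a + 1 := by
        by_cases hb : (y.1 + 1, y.2) ∈ Z
        · exact absurd (hZ _ hx _ hb (x.1 + 1) x.2 (by simp) (by simp [h1]) le_rfl h2.le) fx.2.1
        · have ha : (y.1 - 1, y.2) ∈ Z := by
            by_contra ha
            exact fy ⟨hy, hb, ha⟩
          have := h.2 _ ha _ hy rfl (by simp)
          have := hF _ ha
          have := hF _ hy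
          omega
      have e' : FatStaircase.flip Z a F y = F y := if_neg fy
      have := flip_mem hF hx
      omega
    · have e : F x = a := by
        by_cases ha : (x.1 - 1, x.2) ∈ Z
        · exact absurd (hZ _ ha _ hy (y.1 - 1) y.2 (by simp [h1]) (by simp) h2.le le_rfl) fy.2.2
        · have hb : (x.1 + 1, x.2) ∈ Z := by
            by_contra hb
            exact fx ⟨hx, hb, ha⟩
          have := h.2 _ hx _ hb rfl (by simp)
          have := hF _ hb
          have := hF _ hx
          omega
      have e' : FatStaircase.flip Z a F x = F x := if_neg fx
      have := flip_mem hF hy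
      omega
    · simp only [FatStaircase.flip, if_neg fx, if_neg fy]
      exact h.1 x hx y hy h1 h2
  · intro x hx y hy h1 h2
    have hb : (x.1 + 1, x.2) ∈ Z := hZ _ hx _ hy _ _ (by simp) (by omega) le_rfl h1.le
    have ha : (y.1 - 1, y.2) ∈ Z := hZ _ hx _ hy _ _ (by omega) (by simp) h1.le le_rfl
    have fx : ¬ Free Z x := fun h => h.2.1 hb
    have fy : ¬ Free Z y := fun h => h.2.2 ha
    simp only [FatStaircase.flip, if_neg fx, if_neg fy]
    exact h.2 x hx y hy h1 h2

/-- Free boxes are matched by the reflection. The others come in vertical dominoes `a` over `a + 1`,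
whose two boxes are matched with each other. -/
theorem cnt_flip_left (hZ : Convex Z) (hF : ∀ x ∈ Z, F x = a ∨ F x = a + 1) (h : Semi Z F) :
    cnt Z (flip Z a F) a = cnt Z F (a + 1) := by
  classical
  refine card_bij' (fun x _ => if Free Z x then reflectFree Z x else (x.1 + 1, x.2))
    (fun x _ => if Free Z x then reflectFree Z x else (x.1 - 1, x.2)) ?_ ?_ ?_ ?_
  · intro x hx
    rw [mem_filter] at hx ⊢
    by_cases fx : Free Z x
    · have := hF _ (hZ.free_reflectFree fx).1
      have e := hx.2
      simp only [flip, if_pos fx] at e ⊢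
      refine ⟨(hZ.free_reflectFree fx).1, this.resolve_left fun h => ?_⟩
      simp [h] at e
    · have e := hx.2
      simp only [flip, if_neg fx] at e ⊢
      have ha : (x.1 - 1, x.2) ∉ Z := fun ha => by
        have := h.2 _ ha _ hx.1 rfl (by simp)
        have := hF _ ha
        omega
      have hb : (x.1 + 1, x.2) ∈ Z := by
        by_contra hb
        exact fx ⟨hx.1, hb, ha⟩
      have := h.2 _ hx.1 _ hb rfl (by simp)
      have := hF _ hb
      exact ⟨hb, by omega⟩
  · intro x hx
    rw [mem_filter] at hx ⊢
    by_cases fx : Free Z x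
    · simp only [if_pos fx]
      refine ⟨(hZ.free_reflectFree fx).1, ?_⟩
      simp [flip, hZ.free_reflectFree fx, reflectFree_reflectFree, hx.2]
    · simp only [if_neg fx]
      have hb : (x.1 + 1, x.2) ∉ Z := fun hb => by
        have := h.2 _ hx.1 _ hb rfl (by simp)
        have := hF _ hb
        omega
      have ha : (x.1 - 1, x.2) ∈ Z := by
        by_contra ha
        exact fx ⟨hx.1, hb, ha⟩
      have := h.2 _ ha _ hx.1 rfl (by simp)
      have := hF _ ha
      refine ⟨ha, ?_⟩
      rw [flip, if_neg]
      · omega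
      · intro f
        exact f.2.1 (by simpa using hx.1)
  · intro x hx
    rw [mem_filter] at hx
    by_cases fx : Free Z x
    · simp [fx, hZ.free_reflectFree fx, reflectFree_reflectFree]
    · have : ¬ Free Z (x.1 + 1, x.2) := fun f => f.2.2 (by simpa using hx.1)
      simp [fx, this]
  · intro x hx
    rw [mem_filter] at hx
    by_cases fx : Free Z x
    · simp [fx, hZ.free_reflectFree fx, reflectFree_reflectFree]
    · have : ¬ Free Z (x.1 - 1, x.2) := fun f => f.2.1 (by simpa using hx.1)
      simp [fx, this]

theorem cnt_flip_right (hZ : Convex Z) (hF : ∀ x ∈ Z, F x = a ∨ F x = a + 1) (h : Semi Z F) :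
    cnt Z (flip Z a F) (a + 1) = cnt Z F a := by
  have := cnt_flip_left hZ (fun x hx => flip_mem hF hx) (h.flip hZ hF)
  rw [flip_flip hZ hF] at this
  exact this.symm

end flip
end FatStaircase
end

/-! ### The lattice condition and the flip after its first violation. -/

noncomputable section
namespace FatStaircase
open Finset

/-- `x` is not read after `c`, when rows are read downwards and each row from right to left. -/
def Before (c x : ℤ × ℤ) : Prop := x.1 < c.1 ∨ (x.1 = c.1 ∧ c.2 ≤ x.2)

instance (c : ℤ × ℤ) : DecidablePred (Before c) := fun _ => by unfold Before; infer_instance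

theorem before_refl (c : ℤ × ℤ) : Before c c := .inr ⟨rfl, le_rfl⟩

theorem Before.trans {x y z : ℤ × ℤ} (h : Before x y) (h' : Before y z) : Before x z := by
  unfold Before at *; omega

theorem Before.antisymm {x y : ℤ × ℤ} (h : Before x y) (h' : Before y x) : x = y := by
  unfold Before at *; ext <;> omega

theorem before_total (x y : ℤ × ℤ) : Before x y ∨ Before y x := by
  unfold Before; omega

theorem exists_last {S : Diagram} (h : S.Nonempty) : ∃ c ∈ S, ∀ x ∈ S, Before c x := by
  obtain ⟨c, hc, m⟩ := exists_max_image S (fun x => toLex (x.1, -x.2)) h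
  refine ⟨c, hc, fun x hx => ?_⟩
  have := m x hx
  rw [Prod.Lex.toLex_le_toLex] at this
  unfold Before
  simp only at this
  omega

theorem exists_first {S : Diagram} (h : S.Nonempty) : ∃ c ∈ S, ∀ x ∈ S, Before x c := by
  obtain ⟨c, hc, m⟩ := exists_min_image S (fun x => toLex (x.1, -x.2)) h
  refine ⟨c, hc, fun x hx => ?_⟩
  have := m x hx
  rw [Prod.Lex.toLex_le_toLex] at this
  unfold Before
  simp only at this
  omega

/-- The Littlewood-Richardson condition on a filling, row by row. -/
def Lattice (D : Diagram) (F : ℤ × ℤ → ℕ) : Prop :=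
  ∀ r b, cnt {x ∈ D | x.1 ≤ r} F (b + 1) ≤ cnt {x ∈ D | x.1 < r} F b

/-- The reading word of the filling is not a lattice word after the letter in the box `c`, because
of this letter. -/
def Bad (D : Diagram) (F : ℤ × ℤ → ℕ) (c : ℤ × ℤ) : Prop :=
  c ∈ D ∧ 0 < F c ∧ cnt {x ∈ D | Before c x} F (F c - 1) < cnt {x ∈ D | Before c x} F (F c)

/-- `c` is the first bad box in the reading order. -/
def FirstBad (D : Diagram) (F : ℤ × ℤ → ℕ) (c : ℤ × ℤ) : Prop :=
  Bad D F c ∧ ∀ x, Before c x → x ≠ c → ¬ Bad D F x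

variable {D : Diagram} {F : ℤ × ℤ → ℕ}

theorem Lattice.congr {G : ℤ × ℤ → ℕ} (h : Lattice D F) (e : ∀ x ∈ D, F x = G x) :
    Lattice D G := fun r b => by
  rw [← cnt_congr fun x hx => e x (mem_of_mem_filter x hx),
    ← cnt_congr fun x hx => e x (mem_of_mem_filter x hx)]
  exact h r b

theorem Bad.congr {G : ℤ × ℤ → ℕ} {c : ℤ × ℤ} (h : Bad D F c)
    (e : ∀ x ∈ D, Before c x → F x = G x) : Bad D G c := by
  obtain ⟨h1, h2, h3⟩ := h
  have e' : ∀ x ∈ {x ∈ D | Before c x}, F x = G x := fun x hx =>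
    e x (mem_filter.1 hx).1 (mem_filter.1 hx).2
  have ec := e c h1 (before_refl c)
  rw [ec, cnt_congr e', cnt_congr e'] at h3
  exact ⟨h1, ec ▸ h2, h3⟩

theorem FirstBad.congr {G : ℤ × ℤ → ℕ} {c : ℤ × ℤ} (h : FirstBad D F c)
    (e : ∀ x ∈ D, Before c x → F x = G x) : FirstBad D G c :=
  ⟨h.1.congr e, fun x hx hxc hb => h.2 x hx hxc
    (hb.congr fun y hy hxy => (e y hy (hx.trans hxy)).symm)⟩

theorem FirstBad.unique {c c' : ℤ × ℤ} (h : FirstBad D F c) (h' : FirstBad D F c') : c = c' := by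
  by_contra hne
  rcases before_total c c' with hb | hb
  · exact h.2 _ hb (Ne.symm hne) h'.1
  · exact h'.2 _ hb hne h.1

/-- It suffices to look at the last `b + 1` read in these rows. In its own row only entries at least
`b + 1` have been read by then, so every `b` read so far lies strictly above. -/
theorem row_le_of_not_bad (hF : Semi D F) {r : ℤ} (h : ∀ c, c.1 ≤ r → ¬ Bad D F c) (b : ℕ) :
    cnt {x ∈ D | x.1 ≤ r} F (b + 1) ≤ cnt {x ∈ D | x.1 < r} F b := by
  rcases (filter (fun x => F x = b + 1) {x ∈ D | x.1 ≤ r}).eq_empty_or_nonempty with e | ne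
  · simp [cnt, e]
  obtain ⟨c, hc, m⟩ := exists_last ne
  simp only [mem_filter] at hc m
  have nb := h c hc.1.2
  simp only [Bad, hc.1.1, hc.2, true_and, not_and, not_lt, Nat.add_sub_cancel] at nb
  refine le_trans (card_le_card fun x hx => ?_) ((nb (by omega)).trans (card_le_card fun x hx => ?_))
  · simp only [mem_filter] at hx ⊢
    exact ⟨⟨hx.1.1, m x hx⟩, hx.2⟩
  · simp only [mem_filter] at hx ⊢
    refine ⟨⟨hx.1.1, ?_⟩, hx.2⟩
    rcases hx.1.2 with l | ⟨l1, l2⟩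
    · omega
    · have ne : c.2 ≠ x.2 := fun e => by
        have : c = x := Prod.ext l1.symm e
        subst this
        omega
      have := hF.1 c hc.1.1 x hx.1.1 l1.symm (lt_of_le_of_ne l2 ne)
      omega

theorem Lattice.not_bad (h : Lattice D F) (c : ℤ × ℤ) : ¬ Bad D F c := by
  rintro ⟨h1, h2, h3⟩
  obtain ⟨b, hb⟩ : ∃ b, F c = b + 1 := ⟨F c - 1, by omega⟩
  rw [hb, Nat.add_sub_cancel] at h3
  have l := h c.1 b
  have l1 : cnt {x ∈ D | Before c x} F (b + 1) ≤ cnt {x ∈ D | x.1 ≤ c.1} F (b + 1) :=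
    cnt_mono (monotone_filter_right D fun x _ hx => by unfold Before at hx; omega) _ _
  have l2 : cnt {x ∈ D | x.1 < c.1} F b ≤ cnt {x ∈ D | Before c x} F b :=
    cnt_mono (monotone_filter_right D fun x _ hx => .inl hx) _ _
  omega

theorem exists_firstBad (hF : Semi D F) (h : ¬ Lattice D F) : ∃ c, FirstBad D F c := by
  classical
  have : (D.filter (Bad D F)).Nonempty := by
    by_contra hne
    refine h fun r b => row_le_of_not_bad hF (fun c _ hc => hne ⟨c, ?_⟩) b
    exact mem_filter.2 ⟨hc.1, hc⟩
  obtain ⟨c, hc, m⟩ := exists_first this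
  exact ⟨c, (mem_filter.1 hc).2, fun x hx hne hb =>
    hne ((m x (mem_filter.2 ⟨hb.1, hb⟩)).antisymm hx)⟩

/-- The boxes read after `c` with entries `a` or `a + 1`. -/
def restOf (D : Diagram) (c : ℤ × ℤ) (a : ℕ) (F : ℤ × ℤ → ℕ) : Diagram :=
  {x ∈ D | ¬ Before c x ∧ (F x = a ∨ F x = a + 1)}

theorem mem_restOf {c x : ℤ × ℤ} {a : ℕ} :
    x ∈ restOf D c a F ↔ x ∈ D ∧ ¬ Before c x ∧ (F x = a ∨ F x = a + 1) := mem_filter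

section
variable {c : ℤ × ℤ} {a : ℕ}

/-- The preceding `a + 1`, if there is one, was not bad, so the excess caused by `c` is exactly one.
-/
theorem FirstBad.cnt_eq (h : FirstBad D F c) (ha : F c = a + 1) :
    cnt {x ∈ D | Before c x} F (a + 1) = cnt {x ∈ D | Before c x} F a + 1 := by
  obtain ⟨⟨h1, h2, h3⟩, h4⟩ := h
  rw [ha, Nat.add_sub_cancel] at h3
  set S := ({x ∈ D | Before c x} : Diagram).filter (fun x => F x = a + 1) with hS
  have hc : c ∈ S := by simp [hS, h1, before_refl, ha]
  have e : cnt {x ∈ D | Before c x} F (a + 1) = #(S.erase c) + 1 := (card_erase_add_one hc).symm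
  rcases (S.erase c).eq_empty_or_nonempty with e' | ne
  · rw [e', card_empty] at e
    omega
  · obtain ⟨c', hc', m⟩ := exists_last ne
    simp only [mem_erase, hS, mem_filter] at hc' m
    have nb := h4 c' hc'.2.1.2 hc'.1
    simp only [Bad, hc'.2.1.1, hc'.2.2, true_and, not_and, not_lt, Nat.add_sub_cancel] at nb
    have l1 : #(S.erase c) ≤ cnt {x ∈ D | Before c' x} F (a + 1) := card_le_card fun x hx => by
      simp only [mem_erase, hS, mem_filter] at hx ⊢
      exact ⟨⟨hx.2.1.1, m x hx⟩, hx.2.2⟩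
    have l2 : cnt {x ∈ D | Before c' x} F a ≤ cnt {x ∈ D | Before c x} F a :=
      cnt_mono (monotone_filter_right D fun x _ hx => hc'.2.1.2.trans hx) _ _
    have := nb (by omega)
    omega

/-- A box of the rectangle that is read before `c` would lie in the row of `c`, weakly to its right.
Then `y` would be strictly below a box with entry at least `a + 1`. -/
theorem convex_restOf (hD : Convex D) (hF : Semi D F) (hc : c ∈ D) (ha : F c = a + 1) :
    Convex (restOf D c a F) := by
  intro x hx y hy i j h1 h2 h3 h4
  rw [mem_restOf] at hx hy ⊢
  have hz := hD x hx.1 y hy.1 i j h1 h2 h3 h4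
  have l1 := hF.le hD hx.1 hz h1 h3
  have l2 := hF.le hD hz hy.1 h2 h4
  refine ⟨hz, fun hb => ?_, by omega⟩
  have hx' := hx.2.1
  have hy' := hy.2.1
  unfold Before at hb hx' hy'
  simp only at hb
  have hw : (c.1, y.2) ∈ D := hD c hc y hy.1 _ _ le_rfl (by omega) (by omega) le_rfl
  have l3 := hF.le hD hc hw le_rfl (by simp only; omega)
  have l4 := hF.2 _ hw y hy.1 rfl (by simp only; omega)
  have := hy.2.2
  omega

/-- A box with entry `a + 1` that is read after `c` is not below a box with entry `a` that is read
before `c`. -/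
theorem FirstBad.above (hD : Convex D) (hF : Semi D F) (h : FirstBad D F c) (ha : F c = a + 1)
    {x y : ℤ × ℤ} (hx : x ∈ D) (hy : y ∈ D) (hxb : ¬ Before c x) (hyb : Before c y)
    (h1 : y.2 = x.2) (h2 : y.1 < x.1) (ex : F x = a + 1) : F y < a := by
  by_contra hlt
  have l := hF.2 y hy x hx h1 h2
  have ey : F y = a := by omega
  have hc := h.1.1
  have hrow : x.1 = y.1 + 1 := by
    by_contra hne
    have hz : (y.1 + 1, y.2) ∈ D := hD y hy x hx _ _ (by simp) (by omega) le_rfl h1.le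
    have := hF.2 y hy _ hz rfl (by simp)
    have := hF.2 _ hz x hx h1 (by simp only; omega)
    omega
  unfold Before at hxb hyb
  have hxc : x.1 = c.1 := by
    by_contra hne
    have l' := hF.le hD hc hy (by omega) (by omega)
    omega
  have hxc2 : x.2 < c.2 := by omega
  -- the boxes with `a + 1` in the row of `c`, not read after `c`, lie below boxes with `a`
  have hB : #{z ∈ D | z.1 = c.1 ∧ c.2 ≤ z.2 ∧ F z = a + 1} ≤ #{z ∈ D | z.1 = c.1 - 1 ∧ F z = a} := by
    refine card_le_card_of_injOn (fun z => (z.1 - 1, z.2)) (fun z hz => ?_) (fun z _ w _ e => ?_)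
    · simp only [coe_filter, Set.mem_ofPred_eq] at hz ⊢
      obtain ⟨hz, hz1, hz2, hz3⟩ := hz
      have hm : (z.1 - 1, z.2) ∈ D := hD y hy z hz _ _ (by omega) (by omega) (by omega) le_rfl
      have := hF.2 _ hm z hz rfl (by simp)
      have := hF.le hD hy hm (by simp only; omega) (by simp only; omega)
      exact ⟨hm, by omega, by omega⟩
    · simp only [Prod.mk.injEq] at e
      exact Prod.ext (by omega) e.2
  -- No box above the row of `c` is bad, so the letters `a + 1` up to row `c.1 - 1` are outnumbered
  -- by the letters `a` above that row. Together with `hB`, this leaves no excess of `a + 1` at `c`,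
  -- against `FirstBad.cnt_eq`.
  have hrows := row_le_of_not_bad hF (r := c.1 - 1) (fun d hd => h.2 d (.inl (by omega))
    (fun e => by rw [e] at hd; omega)) a
  have e1 : cnt {z ∈ D | Before c z} F (a + 1) ≤
      cnt {z ∈ D | z.1 ≤ c.1 - 1} F (a + 1) + #{z ∈ D | z.1 = c.1 ∧ c.2 ≤ z.2 ∧ F z = a + 1} := by
    refine le_trans (card_le_card fun z hz => ?_) (card_union_le _ _)
    simp only [mem_union, mem_filter] at hz ⊢
    obtain ⟨⟨hz, hb⟩, e⟩ := hz
    rcases hb with hb | hb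
    · exact .inl ⟨⟨hz, by omega⟩, e⟩
    · exact .inr ⟨hz, hb.1, hb.2, e⟩
  have e2 : cnt {z ∈ D | z.1 < c.1 - 1} F a + #{z ∈ D | z.1 = c.1 - 1 ∧ F z = a} ≤
      cnt {z ∈ D | Before c z} F a := by
    unfold cnt
    rw [← card_union_of_disjoint]
    · refine card_le_card fun z hz => ?_
      simp only [mem_union, mem_filter] at hz ⊢
      rcases hz with ⟨⟨hz, h1⟩, e⟩ | ⟨hz, h1, e⟩
      · exact ⟨⟨hz, .inl (by omega)⟩, e⟩
      · exact ⟨⟨hz, .inl (by omega)⟩, e⟩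
    · rw [disjoint_left]
      intro z hz hz'
      simp only [mem_filter] at hz hz'
      omega
  have := h.cnt_eq ha
  omega

theorem flip_restOf_eq {x : ℤ × ℤ} (h : Before c x ∨ (F x ≠ a ∧ F x ≠ a + 1)) :
    flip (restOf D c a F) a F x = F x :=
  flip_of_not_mem fun hx => by
    rw [mem_restOf] at hx
    tauto

theorem restOf_values : ∀ x ∈ restOf D c a F, F x = a ∨ F x = a + 1 :=
  fun _ hx => (mem_restOf.1 hx).2.2

theorem restOf_flip : restOf D c a (flip (restOf D c a F) a F) = restOf D c a F := by
  ext x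
  by_cases hx : x ∈ restOf D c a F
  · have := flip_mem restOf_values hx
    have h' := mem_restOf.1 hx
    simp only [hx, iff_true]
    exact mem_restOf.2 ⟨h'.1, h'.2.1, this⟩
  · simp only [hx, iff_false]
    rw [mem_restOf, flip_of_not_mem hx, ← mem_restOf]
    exact hx

/-- The delicate pair is an unchanged `a`, read before `c`, above an `a + 1` that may become `a`;
`FirstBad.above` excludes it. In the row of `c`, the unchanged boxes to the right of flipped ones
have entries at least `a + 1`. -/
theorem FirstBad.semi_flip (hD : Convex D) (hF : Semi D F) (h : FirstBad D F c)
    (ha : F c = a + 1) : Semi D (flip (restOf D c a F) a F) := by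
  have hc := h.1.1
  set Z := restOf D c a F with hZ
  have vZ : ∀ x ∈ Z, F x = a ∨ F x = a + 1 := restOf_values
  have cZ : Convex Z := convex_restOf hD hF hc ha
  have sZ : Semi Z (flip Z a F) := (hF.mono (filter_subset _ _)).flip cZ restOf_values
  constructor
  · intro x hx y hy h1 h2
    have l := hF.1 x hx y hy h1 h2
    by_cases zx : x ∈ Z <;> by_cases zy : y ∈ Z
    · exact sZ.1 x zx y zy h1 h2
    · have := flip_mem vZ zx
      rw [flip_of_not_mem zy]
      have vx := restOf_values x zx
      by_cases hb : Before c y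
      · have hx' := (mem_restOf.1 zx).2.1
        unfold Before at hb hx'
        have := hF.le hD hc hy (by omega) (by omega)
        omega
      · have : ¬ (F y = a ∨ F y = a + 1) := fun hv => zy (mem_restOf.2 ⟨hy, hb, hv⟩)
        omega
    · have := flip_mem vZ zy
      rw [flip_of_not_mem zx]
      have vy := restOf_values y zy
      by_cases hb : Before c x
      · have hy' := (mem_restOf.1 zy).2.1
        unfold Before at hb hy'
        omega
      · have : ¬ (F x = a ∨ F x = a + 1) := fun hv => zx (mem_restOf.2 ⟨hx, hb, hv⟩)
        omega
    · rw [flip_of_not_mem zx, flip_of_not_mem zy]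
      exact l
  · intro x hx y hy h1 h2
    have l := hF.2 x hx y hy h1 h2
    by_cases zx : x ∈ Z <;> by_cases zy : y ∈ Z
    · exact sZ.2 x zx y zy h1 h2
    · have := flip_mem vZ zx
      rw [flip_of_not_mem zy]
      have vx := restOf_values x zx
      by_cases hb : Before c y
      · have hx' := (mem_restOf.1 zx).2.1
        unfold Before at hb hx'
        omega
      · have : ¬ (F y = a ∨ F y = a + 1) := fun hv => zy (mem_restOf.2 ⟨hy, hb, hv⟩)
        omega
    · have := flip_mem vZ zy
      rw [flip_of_not_mem zx]
      have vy := restOf_values y zy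
      by_cases hb : Before c x
      · rcases vy with vy | vy
        · omega
        · have := h.above hD hF ha hy hx (mem_restOf.1 zy).2.1 hb h1 h2 vy
          omega
      · have : ¬ (F x = a ∨ F x = a + 1) := fun hv => zx (mem_restOf.2 ⟨hx, hb, hv⟩)
        omega
    · rw [flip_of_not_mem zx, flip_of_not_mem zy]
      exact l

theorem flip_lt_of_lt {Z : Diagram} (hZ : ∀ x ∈ Z, F x = a ∨ F x = a + 1) {n : ℕ} (hn : a + 1 < n)
    {x : ℤ × ℤ} (hx : F x < n) : flip Z a F x < n := by
  by_cases zx : x ∈ Z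
  · have := flip_mem hZ zx
    omega
  · rwa [flip_of_not_mem zx]

/-- The number of entries in the rest of the diagram after the involution. -/
theorem cnt_flip_sub {Z E : Diagram} (hE : Z ⊆ E)
    (hZE : ∀ x ∈ E, F x = a ∨ F x = a + 1 → x ∈ Z)
    (cZ : Convex Z) (hZ : ∀ x ∈ Z, F x = a ∨ F x = a + 1) (sZ : Semi Z F) :
    cnt E (flip Z a F) a = cnt E F (a + 1) ∧ cnt E (flip Z a F) (a + 1) = cnt E F a ∧
      ∀ b, b ≠ a → b ≠ a + 1 → cnt E (flip Z a F) b = cnt E F b := by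
  have key : ∀ b, (b = a ∨ b = a + 1) → ∀ G : ℤ × ℤ → ℕ, (∀ x ∉ Z, G x = F x) →
      cnt E G b = cnt Z G b := by
    intro b hb G hG
    unfold cnt
    congr 1
    ext x
    simp only [mem_filter]
    refine ⟨fun hx => ⟨?_, hx.2⟩, fun hx => ⟨hE hx.1, hx.2⟩⟩
    by_contra zx
    have := hG x zx
    exact zx (hZE x hx.1 (by omega))
  have hf : ∀ x ∉ Z, flip Z a F x = F x := fun x hx => flip_of_not_mem hx
  refine ⟨?_, ?_, fun b h1 h2 => ?_⟩
  · rw [key a (.inl rfl) _ hf, key (a + 1) (.inr rfl) F fun _ _ => rfl, cnt_flip_left cZ hZ sZ]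
  · rw [key (a + 1) (.inr rfl) _ hf, key a (.inl rfl) F fun _ _ => rfl, cnt_flip_right cZ hZ sZ]
  · unfold cnt
    congr 1
    refine filter_congr fun x hx => ?_
    by_cases zx : x ∈ Z
    · have := flip_mem hZ zx
      have := hZ x zx
      omega
    · rw [hf x zx]

/-- The boxes up to `c` have one more `a + 1` than `a` and are kept, while the two counts in the
rest are exchanged. The offset by one is what makes the flip an exact transposition of the vector
`cnt D F i - i`. -/
theorem FirstBad.cnt_flip (hD : Convex D) (hF : Semi D F) (h : FirstBad D F c)
    (ha : F c = a + 1) :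
    cnt D (flip (restOf D c a F) a F) a + 1 = cnt D F (a + 1) ∧
    cnt D (flip (restOf D c a F) a F) (a + 1) = cnt D F a + 1 ∧
      ∀ b, b ≠ a → b ≠ a + 1 → cnt D (flip (restOf D c a F) a F) b = cnt D F b := by
  have hc := h.1.1
  have hr := cnt_flip_sub (E := {x ∈ D | ¬ Before c x}) (Z := restOf D c a F)
    (fun x hx => mem_filter.2 ⟨(mem_restOf.1 hx).1, (mem_restOf.1 hx).2.1⟩)
    (fun x hx hv => mem_restOf.2 ⟨(mem_filter.1 hx).1, (mem_filter.1 hx).2, hv⟩)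
    (convex_restOf hD hF hc ha) restOf_values (hF.mono (filter_subset _ _))
  have hp : ∀ b, cnt {x ∈ D | Before c x} (flip (restOf D c a F) a F) b =
      cnt {x ∈ D | Before c x} F b := cnt_congr fun x hx =>
    flip_restOf_eq (.inl (mem_filter.1 hx).2)
  have e := h.cnt_eq ha
  have s : ∀ G b, cnt {x ∈ D | Before c x} G b + cnt {x ∈ D | ¬ Before c x} G b = cnt D G b :=
    fun G b => cnt_filter_add D _ G b
  refine ⟨?_, ?_, fun b h1 h2 => ?_⟩
  · have := s F (a + 1)
    have := s (flip (restOf D c a F) a F) a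
    have := hp a
    omega
  · have := s F a
    have := s (flip (restOf D c a F) a F) (a + 1)
    have := hp (a + 1)
    omega
  · have := s F b
    have := s (flip (restOf D c a F) a F) b
    have := hp b
    have := hr.2.2 b h1 h2
    omega

end
end FatStaircase
end

/-! ### Cancellation of the fillings that are not lattice. -/

noncomputable section
namespace FatStaircase
open Finset Equiv

variable {D : Diagram}

/-- The extension by zero of a filling. -/
def extend (T : D → ℕ) (x : ℤ × ℤ) : ℕ := if h : x ∈ D then T ⟨x, h⟩ else 0

theorem extend_apply (T : D → ℕ) {x : ℤ × ℤ} (h : x ∈ D) : extend T x = T ⟨x, h⟩ := dif_pos h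

/-- The restriction to `D` of a filling of the plane. -/
def restr (D : Diagram) (F : ℤ × ℤ → ℕ) : D → ℕ := fun x => F x

theorem extend_restr (F : ℤ × ℤ → ℕ) : ∀ x ∈ D, extend (restr D F) x = F x :=
  fun _ h => extend_apply _ h

theorem restr_extend (T : D → ℕ) : restr D (extend T) = T := by
  funext x
  simp [restr, extend]

/-- Both sides vanish outside `D`, so the identities for `flip` can be iterated as equalities of
functions on the plane. -/
theorem extend_restr_flip (T : D → ℕ) {Z : Diagram} (hZ : Z ⊆ D) (a : ℕ) :
    extend (restr D (flip Z a (extend T))) = flip Z a (extend T) := by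
  funext x
  by_cases h : x ∈ D
  · exact extend_restr _ x h
  · rw [flip_of_not_mem fun hx => h (hZ hx)]
    simp [extend, h]

theorem semi_extend_iff (T : D → ℕ) : Semi D (extend T) ↔ IsSemistandard D T := by
  refine and_congr ⟨fun h x y h1 h2 => ?_, fun h x hx y hy h1 h2 => ?_⟩
    ⟨fun h x y h1 h2 => ?_, fun h x hx y hy h1 h2 => ?_⟩
  · simpa [extend] using h x x.2 y y.2 h1 h2
  · simpa [extend, hx, hy] using h ⟨x, hx⟩ ⟨y, hy⟩ h1 h2
  · simpa [extend] using h x x.2 y y.2 h1 h2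
  · simpa [extend, hx, hy] using h ⟨x, hx⟩ ⟨y, hy⟩ h1 h2

theorem content_apply (T : D → ℕ) (b : ℕ) : content T b = cnt D (extend T) b := by
  classical
  rw [content, Finsupp.finsetSum_apply]
  simp only [Finsupp.single_apply]
  rw [← card_filter, cnt]
  refine card_bij (fun x _ => x.1) (fun x hx => ?_) (fun x _ y _ e => Subtype.ext e)
    fun x hx => ?_
  · have := (mem_filter.1 hx).2
    exact mem_filter.2 ⟨x.2, by rw [extend_apply T x.2]; exact this⟩
  · have h := mem_filter.1 hx
    exact ⟨⟨x, h.1⟩, mem_filter.2 ⟨mem_univ _, by rw [← extend_apply T h.1]; exact h.2⟩, rfl⟩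

open Classical in
/-- The semistandard fillings of `D` with entries less than `n`. -/
def fillings (D : Diagram) (n : ℕ) : Finset (D → ℕ) :=
  {T ∈ Fintype.piFinset fun _ : D => range n | Semi D (extend T)}

theorem mem_fillings {n : ℕ} {T : D → ℕ} :
    T ∈ fillings D n ↔ (∀ x, T x < n) ∧ Semi D (extend T) := by
  simp [fillings]

theorem restr_mem_fillings {n : ℕ} {F : ℤ × ℤ → ℕ} :
    restr D F ∈ fillings D n ↔ (∀ x ∈ D, F x < n) ∧ Semi D F := by
  rw [mem_fillings]
  refine and_congr ⟨fun h x hx => h ⟨x, hx⟩, fun h x => h x x.2⟩ ⟨fun h => ?_, fun h => ?_⟩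
  · exact h.congr (extend_restr F)
  · exact h.congr fun x hx => (extend_restr F x hx).symm

theorem Lattice.antitone_cnt {F : ℤ × ℤ → ℕ} (h : Lattice D F) : Antitone (cnt D F) := by
  obtain ⟨r, hr⟩ := (D.image Prod.fst).bddAbove
  refine antitone_nat_of_succ_le fun b => ?_
  have e : ({x ∈ D | x.1 ≤ r} : Diagram) = D :=
    filter_true_of_mem fun x hx => hr (mem_image_of_mem _ hx)
  have := h r b
  rw [e] at this
  exact this.trans (cnt_mono (filter_subset _ _) _ _)

open Classical in
/-- The smaller of the two letters exchanged at the first bad box. -/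
def badLetter (D : Diagram) (F : ℤ × ℤ → ℕ) : ℕ :=
  if h : ∃ c, FirstBad D F c then F h.choose - 1 else 0

open Classical in
/-- The sign reversing involution on the fillings that are not lattice. -/
def flipBad (D : Diagram) (F : ℤ × ℤ → ℕ) : ℤ × ℤ → ℕ :=
  if h : ∃ c, FirstBad D F c then flip (restOf D h.choose (badLetter D F) F) (badLetter D F) F
  else F

theorem FirstBad.badLetter {F : ℤ × ℤ → ℕ} {c : ℤ × ℤ} (h : FirstBad D F c) :
    F c = FatStaircase.badLetter D F + 1 := by
  have e : ∃ c, FirstBad D F c := ⟨c, h⟩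
  rw [FatStaircase.badLetter, dif_pos e, ← h.unique e.choose_spec]
  have := h.1.2.1
  omega

theorem FirstBad.flipBad {F : ℤ × ℤ → ℕ} {c : ℤ × ℤ} (h : FirstBad D F c) :
    flipBad D F =
      flip (restOf D c (FatStaircase.badLetter D F) F) (FatStaircase.badLetter D F) F := by
  have e : ∃ c, FirstBad D F c := ⟨c, h⟩
  rw [FatStaircase.flipBad, dif_pos e, ← h.unique e.choose_spec]

theorem FirstBad.flipBad_eq {F : ℤ × ℤ → ℕ} {c : ℤ × ℤ} (h : FirstBad D F c) :
    ∀ x ∈ D, Before c x → F x = FatStaircase.flipBad D F x := fun x _ hb => by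
  rw [h.flipBad, flip_restOf_eq (.inl hb)]

theorem FirstBad.extend_restr_flipBad {T : D → ℕ} {c : ℤ × ℤ} (h : FirstBad D (extend T) c) :
    extend (restr D (FatStaircase.flipBad D (extend T))) =
      FatStaircase.flipBad D (extend T) := by
  rw [h.flipBad]
  exact extend_restr_flip T (filter_subset _ _) _

/-- Nothing changes up to `c`, so `c` remains the first bad box with the same letter, and the second
flip acts on the same set of boxes. -/
theorem FirstBad.flipBad_flipBad (hD : Convex D) {F : ℤ × ℤ → ℕ} {c : ℤ × ℤ}
    (h : FirstBad D F c) (hF : Semi D F) :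
    FatStaircase.badLetter D (FatStaircase.flipBad D F) = FatStaircase.badLetter D F ∧
    FatStaircase.flipBad D (FatStaircase.flipBad D F) = F := by
  have h' := h.congr h.flipBad_eq
  have ea : FatStaircase.badLetter D (FatStaircase.flipBad D F) =
      FatStaircase.badLetter D F := by
    have := h.badLetter
    have := h'.badLetter
    have := h.flipBad_eq c h.1.1 (before_refl c)
    omega
  refine ⟨ea, ?_⟩
  rw [h'.flipBad, ea, h.flipBad, restOf_flip,
    flip_flip (convex_restOf hD hF h.1.1 h.badLetter) restOf_values]

/-- The adjacent transposition of `a` and `a + 1`. -/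
def adjSwap (n a : ℕ) : Perm (Fin n) :=
  if h : a + 1 < n then swap ⟨a, by omega⟩ ⟨a + 1, h⟩ else 1

theorem adjSwap_adjSwap (n a : ℕ) : adjSwap n a * adjSwap n a = 1 := by
  unfold adjSwap
  split_ifs
  · exact swap_mul_self _ _
  · simp

theorem sign_adjSwap {n a : ℕ} (h : a + 1 < n) : Perm.sign (adjSwap n a) = -1 := by
  rw [adjSwap, dif_pos h, Perm.sign_swap]
  simp

theorem adjSwap_left {n a : ℕ} (h : a + 1 < n) :
    adjSwap n a ⟨a, by omega⟩ = ⟨a + 1, h⟩ := by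
  rw [adjSwap, dif_pos h, swap_apply_left]

theorem adjSwap_right {n a : ℕ} (h : a + 1 < n) :
    adjSwap n a ⟨a + 1, h⟩ = ⟨a, by omega⟩ := by
  rw [adjSwap, dif_pos h, swap_apply_right]

theorem adjSwap_of_ne {n a : ℕ} {i : Fin n} (h1 : i.1 ≠ a) (h2 : i.1 ≠ a + 1) :
    adjSwap n a i = i := by
  unfold adjSwap
  split_ifs
  · exact swap_apply_of_ne_of_ne (fun e => h1 (by rw [e])) fun e => h2 (by rw [e])
  · rfl

/-- The exponent vector of the filling plus the staircase vector. -/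
def shifted (D : Diagram) (F : ℤ × ℤ → ℕ) {n : ℕ} (i : Fin n) : ℤ := (cnt D F i : ℤ) - i

theorem FirstBad.shifted_flipBad (hD : Convex D) {F : ℤ × ℤ → ℕ} {c : ℤ × ℤ}
    (h : FirstBad D F c) (hF : Semi D F) {n : ℕ} (hn : FatStaircase.badLetter D F + 1 < n)
    (i : Fin n) :
    shifted D (FatStaircase.flipBad D F) (adjSwap n (FatStaircase.badLetter D F) i) =
      shifted D F i := by
  rw [h.flipBad]
  have hl := h.badLetter
  generalize FatStaircase.badLetter D F = a at *
  obtain ⟨h1, h2, h3⟩ := h.cnt_flip hD hF hl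
  unfold shifted
  by_cases e1 : i.1 = a
  · have : i = ⟨a, by omega⟩ := Fin.ext e1
    rw [this, adjSwap_left hn]
    simp only
    omega
  by_cases e2 : i.1 = a + 1
  · have : i = ⟨a + 1, hn⟩ := Fin.ext e2
    rw [this, adjSwap_right hn]
    simp only
    omega
  · rw [adjSwap_of_ne e1 e2, h3 _ e1 e2]

theorem perm_eq_one_of_strictAnti {n : ℕ} {u v : Fin n → ℤ} (hu : StrictAnti u)
    (hv : StrictAnti v) {σ : Perm (Fin n)} (h : ∀ i, u (σ i) = v i) : σ = 1 := by
  have hm : StrictMono σ := fun i j hij => by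
    rw [← hu.lt_iff_gt, h, h]
    exact hv hij
  have hm' : StrictMono σ.symm := fun i j hij => by
    rwa [← hm.lt_iff_lt, apply_symm_apply, apply_symm_apply]
  ext i
  have h1 : i ≤ σ i := hm.le_apply
  have h2 : σ i ≤ σ.symm (σ i) := hm'.le_apply
  rw [symm_apply_apply] at h2
  exact congrArg Fin.val (le_antisymm h2 h1)

open Classical in
/-- The alternating sum over the semistandard fillings is the number of lattice fillings. -/
theorem sum_sign_shifted (hD : Convex D) (n : ℕ) {τ : Fin n → ℤ} (hτ : Antitone τ) :
    ∑ T ∈ fillings D n, ∑ σ : Perm (Fin n),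
      (if ∀ i, shifted D (extend T) (σ i) = τ i - i then (Perm.sign σ : ℤ) else 0) =
    #{T ∈ fillings D n | Lattice D (extend T) ∧ ∀ i : Fin n, (cnt D (extend T) i : ℤ) = τ i} := by
  have hτ' : StrictAnti fun i : Fin n => τ i - i := fun i j hij => by
    have := hτ hij.le
    have : (i : ℕ) < j := hij
    simp only
    omega
  rw [← sum_filter_add_sum_filter_not (fillings D n) fun T => Lattice D (extend T)]
  have bad : ∑ T ∈ fillings D n with ¬ Lattice D (extend T), ∑ σ : Perm (Fin n),
      (if ∀ i, shifted D (extend T) (σ i) = τ i - i then (Perm.sign σ : ℤ) else 0) = 0 := by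
    rw [← sum_product']
    -- The flip permutes `shifted` by an adjacent transposition. Multiplying `σ` by it preserves the
    -- condition and reverses the sign, which also excludes fixed points.
    refine sum_involution (fun p _ => (restr D (flipBad D (extend p.1)),
      adjSwap n (badLetter D (extend p.1)) * p.2)) ?_ ?_ ?_ ?_
    · rintro ⟨T, σ⟩ hp
      rw [mem_product, mem_filter, mem_fillings] at hp
      obtain ⟨⟨⟨h1, h2⟩, h3⟩, -⟩ := hp
      obtain ⟨c, hc⟩ := exists_firstBad h2 h3
      have hn : badLetter D (extend T) + 1 < n := by
        rw [← hc.badLetter, extend_apply T hc.1.1]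
        exact h1 _
      have e : ∀ i : Fin n, shifted D (extend (restr D (flipBad D (extend T))))
          ((adjSwap n (badLetter D (extend T)) * σ) i) = shifted D (extend T) (σ i) := by
        intro i
        rw [← hc.shifted_flipBad hD h2 hn (σ i)]
        unfold shifted
        rw [cnt_congr (extend_restr _)]
        rfl
      simp only [e, Perm.sign_mul, sign_adjSwap hn]
      split_ifs <;> simp
    · rintro ⟨T, σ⟩ hp _ he
      rw [mem_product, mem_filter, mem_fillings] at hp
      obtain ⟨⟨⟨h1, h2⟩, h3⟩, -⟩ := hp
      obtain ⟨c, hc⟩ := exists_firstBad h2 h3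
      have hn : badLetter D (extend T) + 1 < n := by
        rw [← hc.badLetter, extend_apply T hc.1.1]
        exact h1 _
      have := congrArg Perm.sign (Prod.ext_iff.1 he).2
      simp only [Perm.sign_mul, sign_adjSwap hn] at this
      rcases Int.units_eq_one_or (Perm.sign σ) with h | h <;> rw [h] at this <;> simp at this
    · rintro ⟨T, σ⟩ hp
      rw [mem_product, mem_filter, mem_fillings] at hp
      obtain ⟨⟨⟨h1, h2⟩, h3⟩, -⟩ := hp
      obtain ⟨c, hc⟩ := exists_firstBad h2 h3
      have hn : badLetter D (extend T) + 1 < n := by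
        rw [← hc.badLetter, extend_apply T hc.1.1]
        exact h1 _
      rw [mem_product, mem_filter, restr_mem_fillings]
      refine ⟨⟨⟨fun x hx => ?_, ?_⟩, fun hl => ?_⟩, mem_univ _⟩
      · rw [hc.flipBad]
        refine flip_lt_of_lt restOf_values hn ?_
        rw [extend_apply T hx]
        exact h1 _
      · rw [hc.flipBad]
        exact hc.semi_flip hD h2 hc.badLetter
      · exact (hl.congr (extend_restr _)).not_bad c (hc.congr hc.flipBad_eq).1
    · rintro ⟨T, σ⟩ hp
      rw [mem_product, mem_filter, mem_fillings] at hp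
      obtain ⟨⟨⟨h1, h2⟩, h3⟩, -⟩ := hp
      obtain ⟨c, hc⟩ := exists_firstBad h2 h3
      have i := hc.flipBad_flipBad hD h2
      refine Prod.ext ?_ ?_
      · simp only
        rw [hc.extend_restr_flipBad, i.2, restr_extend]
      · simp only
        rw [hc.extend_restr_flipBad, i.1, ← mul_assoc, adjSwap_adjSwap, one_mul]
  rw [bad, add_zero, ← filter_filter, card_filter, Nat.cast_sum]
  refine sum_congr rfl fun T hT => ?_
  have hl := (mem_filter.1 hT).2.antitone_cnt
  have hu : StrictAnti (shifted D (extend T) (n := n)) := fun i j hij => by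
    have := hl (show (i : ℕ) ≤ j from hij.le)
    have : (i : ℕ) < j := hij
    unfold shifted
    omega
  -- For a lattice filling both `shifted` and `τ i - i` are strictly decreasing, so only the
  -- identity can match them.
  rw [sum_eq_single 1]
  · have : (∀ i : Fin n, shifted D (extend T) ((1 : Perm (Fin n)) i) = τ i - i) ↔
        ∀ i : Fin n, (cnt D (extend T) i : ℤ) = τ i := by
      refine forall_congr' fun i => ?_
      simp [shifted]
    simp only [this, Perm.sign_one, Units.val_one, Nat.cast_ite, Nat.cast_one, Nat.cast_zero]
  · intro σ _ hσ
    exact if_neg fun h => hσ (perm_eq_one_of_strictAnti hu hτ' h)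
  · simp

end FatStaircase
end

/-! ### Symmetry of skew Schur functions and extraction of coefficients. -/

noncomputable section
namespace FatStaircase
open Finset Equiv

variable {D : Diagram}

/-- The exponent of a monomial in the first `n` variables. -/
def expo {n : ℕ} (v : Fin n → ℤ) : ℕ →₀ ℕ :=
  Finsupp.onFinset (range n) (fun b => if h : b < n then (v ⟨b, h⟩).toNat else 0) fun b hb => by
    by_contra h
    exact hb (dif_neg fun h' => h (mem_range.2 h'))

open Classical in
/-- The coefficient of a monomial in the first `n` variables, zero if an exponent is negative. -/
def coeffAt {n : ℕ} (v : Fin n → ℤ) : MvPowerSeries ℕ ℤ →+ ℤ where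
  toFun f := if ∀ i, 0 ≤ v i then f (expo v) else 0
  map_zero' := by split_ifs <;> rfl
  map_add' f g := by split_ifs <;> rfl

theorem coeffAt_apply {n : ℕ} {v : Fin n → ℤ} (h : ∀ i, 0 ≤ v i) (f : MvPowerSeries ℕ ℤ) :
    coeffAt v f = f (expo v) := if_pos h

theorem content_eq_expo {n : ℕ} {v : Fin n → ℤ} (h : ∀ i, 0 ≤ v i) (T : D → ℕ) :
    content T = expo v ↔ (∀ x, T x < n) ∧ ∀ i : Fin n, (cnt D (extend T) i : ℤ) = v i := by
  constructor
  · intro e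
    have e' : ∀ b, cnt D (extend T) b = expo v b := fun b => by rw [← content_apply, e]
    refine ⟨fun x => ?_, fun i => ?_⟩
    · by_contra hx
      have := e' (T x)
      rw [expo, Finsupp.onFinset_apply, dif_neg hx, cnt, card_eq_zero,
        filter_eq_empty_iff] at this
      exact this x.2 (extend_apply T x.2)
    · rw [e', expo, Finsupp.onFinset_apply, dif_pos i.2]
      exact Int.toNat_of_nonneg (h i)
  · rintro ⟨h1, h2⟩
    ext b
    rw [content_apply, expo, Finsupp.onFinset_apply]
    split_ifs with hb
    · have := h2 ⟨b, hb⟩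
      simp only at this
      omega
    · rw [cnt, card_eq_zero, filter_eq_empty_iff]
      intro x hx e
      rw [extend_apply T hx] at e
      exact hb (e ▸ h1 _)

open Classical in
theorem coeffAt_skewSchur {n : ℕ} (v : Fin n → ℤ) :
    coeffAt v (skewSchur D) =
      #{T ∈ fillings D n | ∀ i : Fin n, (cnt D (extend T) i : ℤ) = v i} := by
  by_cases h : ∀ i, 0 ≤ v i
  · rw [coeffAt_apply h, skewSchur, ← Nat.card_eq_finsetCard]
    congr 1
    refine Nat.card_congr (Equiv.subtypeEquivRight fun T => ?_)
    rw [mem_filter, mem_fillings, content_eq_expo h, semi_extend_iff]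
    tauto
  · rw [eq_comm]
    refine Eq.trans ?_ (if_neg h).symm
    rw [Nat.cast_eq_zero, card_eq_zero, filter_eq_empty_iff]
    intro T _ hT
    exact h fun i => by rw [← hT i]; positivity

/-- The alternating sum of coefficients that extracts the coefficient of a Schur function. -/
def signedCoeff {n : ℕ} (τ : Fin n → ℤ) : MvPowerSeries ℕ ℤ →+ ℤ where
  toFun f := ∑ σ : Perm (Fin n), (Perm.sign σ : ℤ) *
    coeffAt (fun j => τ (σ.symm j) - (σ.symm j : ℕ) + (j : ℕ)) f
  map_zero' := by simp
  map_add' f g := by simp [mul_add, sum_add_distrib]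

theorem signedCoeff_apply {n : ℕ} (τ : Fin n → ℤ) (f : MvPowerSeries ℕ ℤ) :
    signedCoeff τ f = ∑ σ : Perm (Fin n), (Perm.sign σ : ℤ) *
      coeffAt (fun j => τ (σ.symm j) - (σ.symm j : ℕ) + (j : ℕ)) f := rfl

open Classical in
theorem signedCoeff_skewSchur (hD : Convex D) {n : ℕ} {τ : Fin n → ℤ} (hτ : Antitone τ) :
    signedCoeff τ (skewSchur D) =
    #{T ∈ fillings D n | Lattice D (extend T) ∧ ∀ i : Fin n, (cnt D (extend T) i : ℤ) = τ i} := by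
  rw [← sum_sign_shifted hD n hτ, signedCoeff_apply, sum_comm]
  refine sum_congr rfl fun σ _ => ?_
  rw [coeffAt_skewSchur, card_filter, Nat.cast_sum, mul_sum]
  refine sum_congr rfl fun T _ => ?_
  have : (∀ i : Fin n, (cnt D (extend T) i : ℤ) = τ (σ.symm i) - (σ.symm i : ℕ) + (i : ℕ)) ↔
      ∀ i, shifted D (extend T) (σ i) = τ i - i := by
    rw [← σ.forall_congr_right]
    refine forall_congr' fun i => ?_
    rw [symm_apply_apply, shifted]
    constructor <;> intro h <;> linarith
  simp only [this]
  split_ifs <;> simp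

/-- The boxes of `D` with entries `a` or `a + 1`. -/
def pairOf (D : Diagram) (a : ℕ) (F : ℤ × ℤ → ℕ) : Diagram := {x ∈ D | F x = a ∨ F x = a + 1}

theorem pairOf_subset (D : Diagram) (a : ℕ) (F : ℤ × ℤ → ℕ) : pairOf D a F ⊆ D :=
  filter_subset _ _

section
variable {F : ℤ × ℤ → ℕ} {a : ℕ}

theorem pairOf_values : ∀ x ∈ pairOf D a F, F x = a ∨ F x = a + 1 :=
  fun _ hx => (mem_filter.1 hx).2

theorem convex_pairOf (hD : Convex D) (hF : Semi D F) : Convex (pairOf D a F) := by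
  intro x hx y hy i j h1 h2 h3 h4
  rw [pairOf, mem_filter] at hx hy ⊢
  have hz := hD x hx.1 y hy.1 i j h1 h2 h3 h4
  have l1 := hF.le hD hx.1 hz h1 h3
  have l2 := hF.le hD hz hy.1 h2 h4
  exact ⟨hz, by omega⟩

theorem pairOf_flip : pairOf D a (flip (pairOf D a F) a F) = pairOf D a F := by
  ext x
  by_cases hx : x ∈ pairOf D a F
  · have := flip_mem pairOf_values hx
    simp only [hx, iff_true]
    exact mem_filter.2 ⟨(mem_filter.1 hx).1, this⟩
  · simp only [hx, iff_false]
    intro h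
    rw [pairOf, mem_filter, flip_of_not_mem hx] at h
    exact hx (mem_filter.2 h)

theorem semi_flip_pairOf (hD : Convex D) (hF : Semi D F) : Semi D (flip (pairOf D a F) a F) := by
  set Z := pairOf D a F with hZ
  have vZ : ∀ x ∈ Z, F x = a ∨ F x = a + 1 := pairOf_values
  have sZ : Semi Z (flip Z a F) := (hF.mono (filter_subset _ _)).flip (convex_pairOf hD hF) vZ
  have nZ : ∀ x ∈ D, x ∉ Z → F x ≠ a ∧ F x ≠ a + 1 := fun x hx zx =>
    ⟨fun e => zx (mem_filter.2 ⟨hx, .inl e⟩), fun e => zx (mem_filter.2 ⟨hx, .inr e⟩)⟩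
  constructor
  · intro x hx y hy h1 h2
    have l := hF.1 x hx y hy h1 h2
    by_cases zx : x ∈ Z <;> by_cases zy : y ∈ Z
    · exact sZ.1 x zx y zy h1 h2
    · have := flip_mem vZ zx
      have := vZ x zx
      have := nZ y hy zy
      rw [flip_of_not_mem zy]
      omega
    · have := flip_mem vZ zy
      have := vZ y zy
      have := nZ x hx zx
      rw [flip_of_not_mem zx]
      omega
    · rwa [flip_of_not_mem zx, flip_of_not_mem zy]
  · intro x hx y hy h1 h2
    have l := hF.2 x hx y hy h1 h2
    by_cases zx : x ∈ Z <;> by_cases zy : y ∈ Z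
    · exact sZ.2 x zx y zy h1 h2
    · have := flip_mem vZ zx
      have := vZ x zx
      have := nZ y hy zy
      rw [flip_of_not_mem zy]
      omega
    · have := flip_mem vZ zy
      have := vZ y zy
      have := nZ x hx zx
      rw [flip_of_not_mem zx]
      omega
    · rwa [flip_of_not_mem zx, flip_of_not_mem zy]

theorem cnt_flip_pairOf (hD : Convex D) (hF : Semi D F) {n : ℕ} (ha : a + 1 < n) (i : Fin n) :
    cnt D (flip (pairOf D a F) a F) i = cnt D F (adjSwap n a i) := by
  obtain ⟨h1, h2, h3⟩ := cnt_flip_sub (E := D) (Z := pairOf D a F) (filter_subset _ _)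
    (fun x hx hv => mem_filter.2 ⟨hx, hv⟩) (convex_pairOf hD hF) pairOf_values
    (hF.mono (filter_subset _ _))
  by_cases e1 : i.1 = a
  · have : i = ⟨a, by omega⟩ := Fin.ext e1
    rw [this, adjSwap_left ha, h1]
  by_cases e2 : i.1 = a + 1
  · have : i = ⟨a + 1, ha⟩ := Fin.ext e2
    rw [this, adjSwap_right ha, h2]
  · rw [adjSwap_of_ne e1 e2, h3 _ e1 e2]

end

/-- The classical Bender–Knuth involution, on all boxes with entries `a` and `a + 1`, is an
injection between the two sets of fillings. -/
theorem coeffAt_adjSwap_le (hD : Convex D) {n a : ℕ} (ha : a + 1 < n) (v : Fin n → ℤ) :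
    coeffAt v (skewSchur D) ≤ coeffAt (v ∘ adjSwap n a) (skewSchur D) := by
  classical
  rw [coeffAt_skewSchur, coeffAt_skewSchur, Nat.cast_le]
  refine card_le_card_of_injOn
    (fun T => restr D (flip (pairOf D a (extend T)) a (extend T))) (fun T hT => ?_) ?_
  · simp only [coe_filter, Set.mem_ofPred_eq, restr_mem_fillings] at hT ⊢
    obtain ⟨hT, e⟩ := hT
    rw [mem_fillings] at hT
    refine ⟨⟨fun x hx => flip_lt_of_lt pairOf_values ha ?_, semi_flip_pairOf hD hT.2⟩, fun i => ?_⟩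
    · rw [extend_apply T hx]
      exact hT.1 _
    · rw [extend_restr_flip _ (pairOf_subset _ _ _), cnt_flip_pairOf hD hT.2 ha, e]
      rfl
  · have inv : Set.LeftInvOn
        (fun T : D → ℕ => restr D (flip (pairOf D a (extend T)) a (extend T)))
        (fun T : D → ℕ => restr D (flip (pairOf D a (extend T)) a (extend T)))
        {T | Semi D (extend T)} := by
      intro T hT
      simp only
      rw [extend_restr_flip _ (pairOf_subset _ _ _), pairOf_flip,
        flip_flip (convex_pairOf hD hT) pairOf_values, restr_extend]
    refine inv.injOn.mono fun T hT => ?_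
    simp only [coe_filter, Set.mem_ofPred_eq, mem_fillings] at hT ⊢
    exact hT.1.2

theorem coeffAt_adjSwap (hD : Convex D) {n a : ℕ} (ha : a + 1 < n) (v : Fin n → ℤ) :
    coeffAt (v ∘ adjSwap n a) (skewSchur D) = coeffAt v (skewSchur D) := by
  refine le_antisymm ?_ (coeffAt_adjSwap_le hD ha v)
  have := coeffAt_adjSwap_le hD ha (v ∘ adjSwap n a)
  rwa [Function.comp_assoc, ← Perm.coe_mul, adjSwap_adjSwap, Perm.coe_one,
    Function.comp_id] at this

theorem coeffAt_comp_perm (hD : Convex D) {n : ℕ} (v : Fin n → ℤ) (σ : Perm (Fin n)) :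
    coeffAt (v ∘ σ) (skewSchur D) = coeffAt v (skewSchur D) := by
  cases n with
  | zero => rw [Subsingleton.elim (v ∘ σ) v]
  | succ n =>
    have hσ : σ ∈ Submonoid.closure (Set.range fun i : Fin n => swap i.castSucc i.succ) := by
      rw [Perm.mclosure_swap_castSucc_succ]
      trivial
    induction hσ using Submonoid.closure_induction_right generalizing v with
    | one => rfl
    | mul_right x _ y hy ih =>
      obtain ⟨i, rfl⟩ := hy
      have e : swap i.castSucc i.succ = adjSwap (n + 1) i := by
        rw [adjSwap, dif_pos (by omega)]
        rfl
      simp only [e]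
      rw [Perm.coe_mul, ← Function.comp_assoc, coeffAt_adjSwap hD (by omega), ih]

/-- The power series that are symmetric and of bounded degree in the first `n` variables. -/
def symmetric (n : ℕ) : AddSubgroup (MvPowerSeries ℕ ℤ) where
  carrier := {f | (∀ (v : Fin n → ℤ) (σ : Perm (Fin n)), coeffAt (v ∘ σ) f = coeffAt v f) ∧
    {v : Fin n → ℤ | coeffAt v f ≠ 0}.Finite}
  add_mem' := by
    rintro f g ⟨h1, h2⟩ ⟨h3, h4⟩
    refine ⟨fun v σ => by simp [h1, h3], (h2.union h4).subset fun v hv => ?_⟩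
    simp only [Set.mem_ofPred_eq, Set.mem_union, map_add] at hv ⊢
    by_contra! h
    exact hv (by simp [h.1, h.2])
  zero_mem' := by simp
  neg_mem' := by
    rintro f ⟨h1, h2⟩
    refine ⟨fun v σ => by rw [map_neg, map_neg, h1], h2.subset fun v hv => ?_⟩
    simpa using hv

theorem skewSchur_mem_symmetric (hD : Convex D) (n : ℕ) : skewSchur D ∈ symmetric n := by
  classical
  refine ⟨coeffAt_comp_perm hD, ?_⟩
  refine ((fillings D n).image fun T => fun i : Fin n =>
    (cnt D (extend T) i : ℤ)).finite_toSet.subset fun v hv => ?_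
  simp only [Set.mem_ofPred_eq, coeffAt_skewSchur, ne_eq, Nat.cast_eq_zero, card_eq_zero,
    filter_eq_empty_iff] at hv
  push Not at hv
  obtain ⟨T, hT, e⟩ := hv
  simp only [coe_image, Set.mem_image, mem_coe]
  exact ⟨T, hT, funext e⟩

/-- Expand `(τ i + (σ i - i)) ^ 2`: the cross term is nonnegative by the rearrangement inequality,
and the last square is positive for some `i`. -/
theorem sum_sq_lt_of_perm {n : ℕ} {τ : Fin n → ℤ} (hτ : Antitone τ) {σ : Perm (Fin n)}
    (hσ : σ ≠ 1) :
    ∑ i, τ i ^ 2 < ∑ j, (τ (σ.symm j) - (σ.symm j : ℕ) + (j : ℕ)) ^ 2 := by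
  have e1 : ∑ j, (τ (σ.symm j) - (σ.symm j : ℕ) + (j : ℕ)) ^ 2 =
      ∑ i, (τ i - (i : ℕ) + (σ i : ℕ)) ^ 2 := by
    rw [← Equiv.sum_comp σ]
    simp
  have e2 : ∑ i : Fin n, (τ i - (i : ℕ) + (σ i : ℕ)) ^ 2 =
      ∑ i, τ i ^ 2 + 2 * (∑ i : Fin n, τ i * ((σ i : ℕ) : ℤ) - ∑ i : Fin n, τ i * ((i : ℕ) : ℤ)) +
        ∑ i : Fin n, (((σ i : ℕ) : ℤ) - (i : ℕ)) ^ 2 := by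
    rw [← sum_sub_distrib, mul_sum, ← sum_add_distrib, ← sum_add_distrib]
    exact sum_congr rfl fun i _ => by ring
  have h1 : ∑ i : Fin n, τ i * ((i : ℕ) : ℤ) ≤ ∑ i : Fin n, τ i * ((σ i : ℕ) : ℤ) := by
    have : Antivary τ fun i : Fin n => ((i : ℕ) : ℤ) := by
      intro i j hij
      refine hτ ?_
      simp only [Nat.cast_lt] at hij
      exact hij.le
    have := this.sum_smul_le_sum_smul_comp_perm (σ := σ)
    simpa using this
  have h2 : 0 < ∑ i : Fin n, (((σ i : ℕ) : ℤ) - (i : ℕ)) ^ 2 := by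
    obtain ⟨i, hi⟩ : ∃ i, σ i ≠ i := by
      by_contra! h
      exact hσ (Equiv.ext h)
    refine sum_pos' (fun _ _ => sq_nonneg _) ⟨i, mem_univ _, ?_⟩
    have : ((σ i : ℕ) : ℤ) - (i : ℕ) ≠ 0 := fun h => hi (Fin.ext (by omega))
    positivity
  rw [e1, e2]
  linarith

/-- Triangularity: take an exponent `w` of a nonzero coefficient with the largest sum of squares,
and sort it to `τ`. By `sum_sq_lt_of_perm` all terms of `signedCoeff τ f` but the identity term
vanish, so the coefficient at `w` would be zero. -/
theorem coeffAt_eq_zero {n : ℕ} {f : MvPowerSeries ℕ ℤ} (hf : f ∈ symmetric n)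
    (h : ∀ τ : Fin n → ℤ, Antitone τ → signedCoeff τ f = 0) (v : Fin n → ℤ) : coeffAt v f = 0 := by
  by_contra hv
  obtain ⟨hs, hfin⟩ := hf
  obtain ⟨w, hw, hmax⟩ := hfin.toFinset.exists_max_image (fun v => ∑ i, v i ^ 2)
    ⟨v, by simpa using hv⟩
  simp only [Set.Finite.mem_toFinset, Set.mem_ofPred_eq] at hw hmax
  set τ : Fin n → ℤ := w ∘ Tuple.sort (-w) with hτ
  have anti : Antitone τ := fun i j hij => by
    have := Tuple.monotone_sort (-w) hij
    simpa [hτ] using this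
  have sq : ∑ i, τ i ^ 2 = ∑ i, w i ^ 2 := Equiv.sum_comp (Tuple.sort (-w)) fun i => w i ^ 2
  have := h τ anti
  rw [signedCoeff_apply, sum_eq_single 1] at this
  · refine hw ?_
    rw [← hs w (Tuple.sort (-w)), ← hτ]
    have e : (fun j => τ ((1 : Perm (Fin n)).symm j) - ((1 : Perm (Fin n)).symm j : ℕ) +
        (j : ℕ)) = τ := funext fun j => by
      rw [← Perm.inv_def, inv_one, Perm.one_apply]
      ring
    rwa [e, Perm.sign_one, Units.val_one, one_mul] at this
  · intro σ _ hσ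
    by_contra hne
    have := hmax _ (right_ne_zero_of_mul hne)
    have := sum_sq_lt_of_perm anti hσ
    omega
  · simp

end FatStaircase
end

/-! ### The Littlewood–Richardson rule and uniqueness of Schur expansions. -/

noncomputable section
namespace FatStaircase
open Finset Equiv

variable {D : Diagram}

/-- The counts decrease, so each value up to `F x` occurs. Hence `fillings D #D` already contains
all lattice fillings. -/
theorem Lattice.lt_card {F : ℤ × ℤ → ℕ} (h : Lattice D F) {x : ℤ × ℤ} (hx : x ∈ D) :
    F x < #D := by
  have hs : range (F x + 1) ⊆ D.image F := fun b hb => by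
    have h1 : 0 < cnt D F (F x) := card_pos.2 ⟨x, mem_filter.2 ⟨hx, rfl⟩⟩
    have h2 := h.antitone_cnt (Nat.lt_succ_iff.1 (mem_range.1 hb))
    obtain ⟨y, hy⟩ := card_pos.1 (h1.trans_le h2)
    exact mem_image.2 ⟨y, mem_filter.1 hy⟩
  have := (card_le_card hs).trans card_image_le
  rwa [card_range] at this

open Classical in
/-- The Littlewood-Richardson fillings of `D`. -/
def latticeFillings (D : Diagram) : Finset (D → ℕ) :=
  {T ∈ fillings D #D | Lattice D (extend T)}

open Classical in
theorem mem_latticeFillings {T : D → ℕ} :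
    T ∈ latticeFillings D ↔ Semi D (extend T) ∧ Lattice D (extend T) := by
  rw [latticeFillings, mem_filter, mem_fillings]
  refine ⟨fun h => ⟨h.1.2, h.2⟩, fun h => ⟨⟨fun x => ?_, h.1⟩, h.2⟩⟩
  rw [← extend_apply T x.2]
  exact h.2.lt_card x.2

theorem restr_mem_latticeFillings {F : ℤ × ℤ → ℕ} :
    restr D F ∈ latticeFillings D ↔ Semi D F ∧ Lattice D F := by
  rw [mem_latticeFillings]
  refine and_congr ⟨fun h => ?_, fun h => ?_⟩ ⟨fun h => ?_, fun h => ?_⟩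
  · exact h.congr (extend_restr F)
  · exact h.congr fun x hx => (extend_restr F x hx).symm
  · exact h.congr (extend_restr F)
  · exact h.congr fun x hx => (extend_restr F x hx).symm

theorem exists_youngDiagram {g : ℕ → ℕ} (hg : Antitone g) {N : ℕ} (hN : ∀ i, N ≤ i → g i = 0) :
    ∃ ν : YoungDiagram, ∀ i, ν.rowLen i = g i := by
  let ν : YoungDiagram :=
    { cells := (range N ×ˢ range (g 0)).filter fun c => c.2 < g c.1
      isLowerSet := by
        rintro ⟨i, j⟩ ⟨i', j'⟩ ⟨h1, h2⟩ h
        simp only [coe_filter, mem_product, mem_range, Set.mem_ofPred_eq] at h h1 h2 ⊢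
        have := hg h1
        omega }
  have hmem : ∀ i j, (i, j) ∈ ν ↔ j < g i := fun i j => by
    rw [← YoungDiagram.mem_cells]
    simp only [ν, mem_filter, mem_product, mem_range]
    refine ⟨fun h => h.2, fun h => ⟨⟨?_, h.trans_le (hg (Nat.zero_le i))⟩, h⟩⟩
    by_contra hi
    have := hN i (not_lt.1 hi)
    omega
  refine ⟨ν, fun i => ?_⟩
  have h1 := (hmem i (g i)).not.2 (lt_irrefl _)
  rw [YoungDiagram.mem_iff_lt_rowLen, not_lt] at h1
  refine le_antisymm h1 (not_lt.1 fun h2 => ?_)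
  rw [← hmem, YoungDiagram.mem_iff_lt_rowLen] at h2
  exact lt_irrefl _ h2

theorem youngDiagram_ext {ν ν' : YoungDiagram} (h : ∀ i, ν.rowLen i = ν'.rowLen i) : ν = ν' := by
  refine YoungDiagram.ext (Finset.ext fun c => ?_)
  rw [YoungDiagram.mem_cells, YoungDiagram.mem_cells, ← Prod.mk.eta (p := c),
    YoungDiagram.mem_iff_lt_rowLen, YoungDiagram.mem_iff_lt_rowLen, h]

theorem exists_rowLen_eq_zero (ν : YoungDiagram) : ∃ N, ∀ i, N ≤ i → ν.rowLen i = 0 := by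
  refine ⟨ν.colLen 0, fun i hi => ?_⟩
  by_contra h
  have : (i, 0) ∈ ν := YoungDiagram.mem_iff_lt_rowLen.2 (Nat.pos_of_ne_zero h)
  rw [YoungDiagram.mem_iff_lt_colLen] at this
  omega

open Classical in
/-- The partition with row lengths `g` (junk if there is none). -/
def partitionOf (g : ℕ → ℕ) : YoungDiagram :=
  if h : ∃ ν : YoungDiagram, ∀ i, ν.rowLen i = g i then h.choose else ⊥

/-- The partition with `cnt D F b` boxes in row `b`, for a lattice filling. -/
def shape (D : Diagram) (F : ℤ × ℤ → ℕ) : YoungDiagram := partitionOf (cnt D F)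

theorem Lattice.cnt_eq_zero {F : ℤ × ℤ → ℕ} (h : Lattice D F) {b : ℕ} (hb : #D ≤ b) :
    cnt D F b = 0 := by
  rw [cnt, card_eq_zero, filter_eq_empty_iff]
  intro x hx e
  have := h.lt_card hx
  omega

theorem Lattice.rowLen_shape {F : ℤ × ℤ → ℕ} (h : Lattice D F) (i : ℕ) :
    (shape D F).rowLen i = cnt D F i := by
  have := exists_youngDiagram h.antitone_cnt fun _ => h.cnt_eq_zero
  rw [shape, partitionOf, dif_pos this]
  exact this.choose_spec i

theorem mem_skewDiagram {lam mu : YoungDiagram} {x : ℤ × ℤ} :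
    x ∈ skewDiagram lam mu ↔ ∃ i j : ℕ, x = (↑i, ↑j) ∧ (i, j) ∈ lam ∧ (i, j) ∉ mu := by
  simp only [skewDiagram, mem_image, mem_sdiff, YoungDiagram.mem_cells, Prod.exists]
  constructor
  · rintro ⟨i, j, h, rfl⟩
    exact ⟨i, j, rfl, h⟩
  · rintro ⟨i, j, rfl, h⟩
    exact ⟨i, j, h, rfl⟩

theorem mem_straight {ν : YoungDiagram} {x : ℤ × ℤ} :
    x ∈ skewDiagram ν ⊥ ↔ ∃ i j : ℕ, x = (↑i, ↑j) ∧ j < ν.rowLen i := by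
  rw [mem_skewDiagram]
  simp only [YoungDiagram.notMem_bot, not_false_eq_true, and_true]
  simp only [YoungDiagram.mem_iff_lt_rowLen]

theorem convex_skewDiagram (lam mu : YoungDiagram) : Convex (skewDiagram lam mu) := by
  intro x hx y hy i j h1 h2 h3 h4
  rw [mem_skewDiagram] at hx hy ⊢
  obtain ⟨i₁, j₁, rfl, -, hx⟩ := hx
  obtain ⟨i₂, j₂, rfl, hy, -⟩ := hy
  simp only at h1 h2 h3 h4
  lift i to ℕ using by omega
  lift j to ℕ using by omega
  refine ⟨i, j, rfl, lam.up_left_mem (by omega) (by omega) hy, fun h => hx ?_⟩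
  exact mu.up_left_mem (by omega) (by omega) h

/-- The filling of a straight shape whose entries in row `i` are `i`. -/
def rowFilling (x : ℤ × ℤ) : ℕ := x.1.toNat

theorem semi_rowFilling (ν : YoungDiagram) : Semi (skewDiagram ν ⊥) rowFilling := by
  constructor
  · intro x _ y _ h _
    simp [rowFilling, h]
  · intro x hx y hy _ h
    obtain ⟨i, j, rfl, -⟩ := mem_straight.1 hx
    obtain ⟨i', j', rfl, -⟩ := mem_straight.1 hy
    simp only [rowFilling] at h ⊢
    omega

theorem cnt_rowFilling (ν : YoungDiagram) (b : ℕ) :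
    cnt (skewDiagram ν ⊥) rowFilling b = ν.rowLen b := by
  rw [← card_range (ν.rowLen b)]
  symm
  refine card_bij (fun j _ => ((b : ℤ), (j : ℤ))) (fun j hj => ?_) (fun j _ j' _ e => ?_)
    fun x hx => ?_
  · exact mem_filter.2 ⟨mem_straight.2 ⟨b, j, rfl, mem_range.1 hj⟩, by simp [rowFilling]⟩
  · simpa using e
  · obtain ⟨hx, e⟩ := mem_filter.1 hx
    obtain ⟨i, j, rfl, h⟩ := mem_straight.1 hx
    simp only [rowFilling, Int.toNat_natCast] at e
    subst e
    exact ⟨j, mem_range.2 h, rfl⟩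

theorem lattice_rowFilling (ν : YoungDiagram) : Lattice (skewDiagram ν ⊥) rowFilling := by
  intro r b
  refine card_le_card_of_injOn (fun x => (x.1 - 1, x.2)) (fun x hx => ?_) fun x _ y _ e => ?_
  · simp only [coe_filter, mem_filter, Set.mem_ofPred_eq] at hx ⊢
    obtain ⟨⟨hx, hr⟩, e⟩ := hx
    obtain ⟨i, j, rfl, h⟩ := mem_straight.1 hx
    simp only [rowFilling, Int.toNat_natCast] at e
    subst e
    simp only [Nat.cast_add, Nat.cast_one, add_sub_cancel_right, rowFilling,
      Int.toNat_natCast, and_true] at hr ⊢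
    exact ⟨mem_straight.2 ⟨b, j, rfl, h.trans_le (ν.rowLen_anti _ _ (by omega))⟩, by omega⟩
  · simp only [Prod.mk.injEq, sub_left_inj] at e
    exact Prod.ext e.1 e.2

/-- Column-strictness bounds an entry below by its row index. The lattice condition puts some `b`
strictly above each `b + 1`, which bounds it above. -/
theorem eq_rowFilling {ν : YoungDiagram} {F : ℤ × ℤ → ℕ} (hF : Semi (skewDiagram ν ⊥) F)
    (h : Lattice (skewDiagram ν ⊥) F) : ∀ x ∈ skewDiagram ν ⊥, F x = rowFilling x := by
  have lower : ∀ i j : ℕ, j < ν.rowLen i → i ≤ F (↑i, ↑j) := by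
    intro i
    induction i with
    | zero => intros; exact Nat.zero_le _
    | succ i ih =>
      intro j hj
      have hj' := hj.trans_le (ν.rowLen_anti i (i + 1) (by omega))
      have := ih j hj'
      have := hF.2 (↑i, ↑j) (mem_straight.2 ⟨i, j, rfl, hj'⟩) (↑(i + 1), ↑j)
        (mem_straight.2 ⟨i + 1, j, rfl, hj⟩) rfl (by simp)
      omega
  have upper : ∀ b, ∀ x ∈ skewDiagram ν ⊥, F x = b → (b : ℤ) ≤ x.1 := by
    intro b
    induction b with
    | zero =>
      intro x hx _
      obtain ⟨i, j, rfl, -⟩ := mem_straight.1 hx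
      simp
    | succ b ih =>
      intro x hx e
      have h1 : 0 < cnt {y ∈ skewDiagram ν ⊥ | y.1 ≤ x.1} F (b + 1) :=
        card_pos.2 ⟨x, mem_filter.2 ⟨mem_filter.2 ⟨hx, le_rfl⟩, e⟩⟩
      obtain ⟨y, hy⟩ := card_pos.1 (h1.trans_le (h x.1 b))
      simp only [mem_filter] at hy
      have := ih y hy.1.1 hy.2
      omega
  intro x hx
  have u := upper _ x hx rfl
  obtain ⟨i, j, rfl, hj⟩ := mem_straight.1 hx
  have l := lower i j hj
  simp only [rowFilling, Int.toNat_natCast] at u ⊢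
  omega

/-- The functionals `signedCoeff` are dual to the Schur functions, because a straight shape has a
single lattice filling. Both the rule and linear independence rest on this. -/
theorem signedCoeff_schur {ν : YoungDiagram} {n : ℕ} (hn : ∀ i, n ≤ i → ν.rowLen i = 0)
    {τ : Fin n → ℤ} (hτ : Antitone τ) [Decidable (∀ i : Fin n, (ν.rowLen i : ℤ) = τ i)] :
    signedCoeff τ (schur ν) = if ∀ i : Fin n, (ν.rowLen i : ℤ) = τ i then 1 else 0 := by
  classical
  rw [schur, signedCoeff_skewSchur (convex_skewDiagram _ _) hτ]
  have hcnt : ∀ T ∈ fillings (skewDiagram ν ⊥) n, Lattice (skewDiagram ν ⊥) (extend T) →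
      ∀ b, cnt (skewDiagram ν ⊥) (extend T) b = ν.rowLen b := fun T hT hl b => by
    rw [cnt_congr (eq_rowFilling (mem_fillings.1 hT).2 hl), cnt_rowFilling]
  split_ifs with h
  · rw [Nat.cast_eq_one, card_eq_one]
    refine ⟨restr _ rowFilling, ?_⟩
    ext T
    rw [mem_filter, mem_singleton]
    constructor
    · rintro ⟨hT, hl, -⟩
      rw [← restr_extend T]
      funext x
      exact eq_rowFilling (mem_fillings.1 hT).2 hl x x.2
    · rintro rfl
      have hmem : restr (skewDiagram ν ⊥) rowFilling ∈ fillings (skewDiagram ν ⊥) n := by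
        refine restr_mem_fillings.2 ⟨fun x hx => ?_, semi_rowFilling ν⟩
        obtain ⟨i, j, rfl, hj⟩ := mem_straight.1 hx
        simp only [rowFilling, Int.toNat_natCast]
        by_contra hi
        have := hn i (not_lt.1 hi)
        omega
      have hl : Lattice (skewDiagram ν ⊥) (extend (restr (skewDiagram ν ⊥) rowFilling)) :=
        (lattice_rowFilling ν).congr fun x hx => (extend_restr _ x hx).symm
      exact ⟨hmem, hl, fun i => by rw [hcnt _ hmem hl, h]⟩
  · rw [Nat.cast_eq_zero, card_eq_zero, filter_eq_empty_iff]
    rintro T hT ⟨hl, hi⟩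
    exact h fun i => by rw [← hi, hcnt T hT hl]

/-- The Littlewood-Richardson rule for the expansion of a skew Schur function. -/
theorem skewSchur_eq_sum (hD : Convex D) :
    skewSchur D = ∑ T ∈ latticeFillings D, schur (shape D (extend T)) := by
  classical
  rw [← sub_eq_zero]
  set f := skewSchur D - ∑ T ∈ latticeFillings D, schur (shape D (extend T)) with hf
  have sym : ∀ n, f ∈ symmetric n := fun n =>
    sub_mem (skewSchur_mem_symmetric hD n)
      (sum_mem fun T _ => skewSchur_mem_symmetric (convex_skewDiagram _ _) n)
  have van : ∀ n, #D ≤ n → ∀ τ : Fin n → ℤ, Antitone τ → signedCoeff τ f = 0 := by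
    intro n hn τ hτ
    rw [hf, map_sub, map_sum, signedCoeff_skewSchur hD hτ, sub_eq_zero, ← filter_filter,
      card_filter, Nat.cast_sum]
    have e : {T ∈ fillings D n | Lattice D (extend T)} = latticeFillings D := by
      ext T
      rw [mem_latticeFillings, mem_filter, mem_fillings]
      refine ⟨fun h => ⟨h.1.2, h.2⟩, fun h => ⟨⟨fun x => ?_, h.1⟩, h.2⟩⟩
      rw [← extend_apply T x.2]
      exact (h.2.lt_card x.2).trans_le hn
    rw [e]
    refine sum_congr rfl fun T hT => ?_
    have hl := (mem_latticeFillings.1 hT).2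
    rw [signedCoeff_schur (fun i hi => ?_) hτ]
    · simp only [hl.rowLen_shape]
      split_ifs <;> simp
    · rw [hl.rowLen_shape, hl.cnt_eq_zero (hn.trans hi)]
  change f = fun _ => 0
  funext d
  obtain ⟨N, hN⟩ := d.support.bddAbove
  -- At least `#D` variables make all signed coefficients of `f` vanish; `N + 1` of them contain the
  -- support of `d`.
  set n := max #D (N + 1)
  set v : Fin n → ℤ := fun i => d i
  have hv : ∀ i, 0 ≤ v i := fun i => by positivity
  have := coeffAt_eq_zero (sym n) (van n (le_max_left _ _)) v
  rw [coeffAt_apply hv] at this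
  rw [← this]
  congr 1
  ext b
  rw [expo, Finsupp.onFinset_apply]
  split_ifs with hb
  · simp [v]
  · by_contra h
    have := hN (Finsupp.mem_support_iff.2 h)
    exact hb (lt_of_lt_of_le (Nat.lt_succ_iff.2 this) (le_max_right _ _))

theorem hasSchurExpansion_iff {f : MvPowerSeries ℕ ℤ} {a : YoungDiagram →₀ ℤ} :
    HasSchurExpansion f a ↔ f = a.sum fun ν z => z • schur ν := Iff.rfl

theorem sum_schur_injective {a : YoungDiagram →₀ ℤ} (h : (a.sum fun ν z => z • schur ν) = 0) :
    a = 0 := by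
  classical
  ext ν
  choose N hN using exists_rowLen_eq_zero
  set n := (insert ν a.support).sup N
  have hn : ∀ ν' ∈ insert ν a.support, ∀ i, n ≤ i → ν'.rowLen i = 0 := fun ν' hν' i hi =>
    hN ν' i ((le_sup hν').trans hi)
  have hτ : Antitone fun i : Fin n => (ν.rowLen i : ℤ) := fun i j hij => by
    simp only [Nat.cast_le]
    exact ν.rowLen_anti _ _ hij
  have := congrArg (signedCoeff fun i : Fin n => (ν.rowLen i : ℤ)) h
  rw [Finsupp.sum, map_sum, map_zero] at this
  rw [Finsupp.zero_apply, ← this]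
  by_cases hν : ν ∈ a.support
  · rw [sum_eq_single ν]
    · rw [map_zsmul, signedCoeff_schur (hn ν (mem_insert_self _ _)) hτ]
      simp
    · intro ν' hν' hne
      rw [map_zsmul, signedCoeff_schur (hn ν' (mem_insert_of_mem hν')) hτ, if_neg, smul_zero]
      intro e
      refine hne (youngDiagram_ext fun i => ?_)
      by_cases hi : i < n
      · exact_mod_cast e ⟨i, hi⟩
      · rw [hn ν' (mem_insert_of_mem hν') i (not_lt.1 hi),
          hn ν (mem_insert_self _ _) i (not_lt.1 hi)]
    · exact fun h => absurd hν h
  · rw [Finsupp.notMem_support_iff.1 hν, eq_comm]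
    refine sum_eq_zero fun ν' hν' => ?_
    rw [map_zsmul, signedCoeff_schur (hn ν' (mem_insert_of_mem hν')) hτ, if_neg, smul_zero]
    intro e
    refine hν ?_
    have : ν' = ν := youngDiagram_ext fun i => by
      by_cases hi : i < n
      · exact_mod_cast e ⟨i, hi⟩
      · rw [hn ν' (mem_insert_of_mem hν') i (not_lt.1 hi),
          hn ν (mem_insert_self _ _) i (not_lt.1 hi)]
    exact this ▸ hν'

theorem HasSchurExpansion.unique {f : MvPowerSeries ℕ ℤ} {a b : YoungDiagram →₀ ℤ}
    (ha : HasSchurExpansion f a) (hb : HasSchurExpansion f b) : a = b := by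
  rw [hasSchurExpansion_iff] at ha hb
  rw [← sub_eq_zero]
  refine sum_schur_injective ?_
  rw [Finsupp.sum_sub_index fun _ _ _ => sub_smul _ _ _, ← ha, ← hb, sub_self]

theorem HasSchurExpansion.sub {f g : MvPowerSeries ℕ ℤ} {a b : YoungDiagram →₀ ℤ}
    (ha : HasSchurExpansion f a) (hb : HasSchurExpansion g b) :
    HasSchurExpansion (f - g) (a - b) := by
  rw [hasSchurExpansion_iff] at *
  rw [Finsupp.sum_sub_index fun _ _ _ => sub_smul _ _ _, ← ha, ← hb]

theorem sum_single_sum {ι : Type*} (s : Finset ι) (p : ι → YoungDiagram)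
    (G : YoungDiagram → MvPowerSeries ℕ ℤ) :
    ((∑ T ∈ s, Finsupp.single (p T) (1 : ℤ)).sum fun ν z => z • G ν) = ∑ T ∈ s, G (p T) := by
  rw [← Finsupp.sum_finsetSum_index (h := fun ν (z : ℤ) => z • G ν) (fun _ => zero_smul _ _)
    fun _ _ _ => add_smul _ _ _]
  refine sum_congr rfl fun T _ => ?_
  rw [Finsupp.sum_single_index (h := fun ν (z : ℤ) => z • G ν) (zero_smul _ _), one_smul]

theorem hasSchurExpansion_sum {ι : Type*} (s : Finset ι) (p : ι → YoungDiagram) :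
    HasSchurExpansion (∑ T ∈ s, schur (p T)) (∑ T ∈ s, Finsupp.single (p T) 1) :=
  (sum_single_sum s p schur).symm

/-- By uniqueness, the expansion chosen in `schurCoeff` is the one that counts lattice fillings. -/
theorem lrCoeff_eq (ρ κ : YoungDiagram) :
    lrCoeff ρ κ = ∑ T ∈ latticeFillings (skewDiagram ρ κ),
      Finsupp.single (shape (skewDiagram ρ κ) (extend T)) 1 := by
  have h := hasSchurExpansion_sum (latticeFillings (skewDiagram ρ κ))
    fun T => shape (skewDiagram ρ κ) (extend T)
  rw [← skewSchur_eq_sum (convex_skewDiagram ρ κ)] at h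
  have e : ∃ a, HasSchurExpansion (skewSchur (skewDiagram ρ κ)) a := ⟨_, h⟩
  rw [lrCoeff, schurCoeff, dif_pos e]
  exact e.choose_spec.unique h

end FatStaircase
end

/-! ### Gluing diagrams, last rows, and the filling of a rotated shape. -/

noncomputable section
namespace FatStaircase
open Finset

/-- The diagram `B`, translated by `o`, together with the diagram `A`. -/
def stack (A B : Diagram) (o : ℤ × ℤ) : Diagram := A ∪ B.image fun c => (o.1 + c.1, o.2 + c.2)

/-- The filling of `B` that is induced by a filling of `stack A B o`. -/
def shift (o : ℤ × ℤ) (F : ℤ × ℤ → ℕ) (c : ℤ × ℤ) : ℕ := F (o.1 + c.1, o.2 + c.2)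

section stack
variable {A B : Diagram} {o : ℤ × ℤ} {F : ℤ × ℤ → ℕ}

theorem mem_stack {x : ℤ × ℤ} :
    x ∈ stack A B o ↔ x ∈ A ∨ ∃ y ∈ B, (o.1 + y.1, o.2 + y.2) = x := by
  rw [stack, mem_union, mem_image]

theorem mem_stack_left {x : ℤ × ℤ} (h : x ∈ A) : x ∈ stack A B o := mem_stack.2 (.inl h)

theorem mem_stack_right {y : ℤ × ℤ} (h : y ∈ B) : (o.1 + y.1, o.2 + y.2) ∈ stack A B o :=
  mem_stack.2 (.inr ⟨y, h, rfl⟩)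

theorem cnt_filter_stack (hA : ∀ x ∈ A, x.1 < o.1) (hB : ∀ y ∈ B, 0 ≤ y.1) (p : ℤ × ℤ → Prop)
    [DecidablePred p] (F : ℤ × ℤ → ℕ) (b : ℕ) :
    cnt {x ∈ stack A B o | p x} F b =
      cnt {x ∈ A | p x} F b + cnt {y ∈ B | p (o.1 + y.1, o.2 + y.2)} (shift o F) b := by
  rw [stack, filter_union, cnt_union]
  · congr 1
    rw [cnt, filter_image, filter_image, card_image_of_injective]
    · rfl
    · intro x y e
      simp only [Prod.mk.injEq, add_right_inj] at e
      exact Prod.ext e.1 e.2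
  · refine disjoint_filter_filter (disjoint_left.2 fun x hx hx' => ?_)
    obtain ⟨y, hy, rfl⟩ := mem_image.1 hx'
    have := hA _ hx
    have := hB y hy
    omega

theorem cnt_stack (hA : ∀ x ∈ A, x.1 < o.1) (hB : ∀ y ∈ B, 0 ≤ y.1) (F : ℤ × ℤ → ℕ) (b : ℕ) :
    cnt (stack A B o) F b = cnt A F b + cnt B (shift o F) b := by
  have := cnt_filter_stack hA hB (fun _ => True) F b
  simpa using this

theorem semi_stack_iff (hA : ∀ x ∈ A, x.1 < o.1) (hB : ∀ y ∈ B, 0 ≤ y.1) :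
    Semi (stack A B o) F ↔ Semi A F ∧ Semi B (shift o F) ∧
      ∀ x ∈ A, ∀ y ∈ B, x.2 = o.2 + y.2 → F x < shift o F y := by
  constructor
  · intro h
    refine ⟨h.mono subset_union_left, ⟨fun x hx y hy h1 h2 => ?_, fun x hx y hy h1 h2 => ?_⟩,
      fun x hx y hy e => ?_⟩
    · exact h.1 _ (mem_stack_right hx) _ (mem_stack_right hy) (by simp [h1]) (by simpa using h2)
    · exact h.2 _ (mem_stack_right hx) _ (mem_stack_right hy) (by simp [h1]) (by simpa using h2)
    · have := hA x hx
      have := hB y hy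
      exact h.2 _ (mem_stack_left hx) _ (mem_stack_right hy) e (by simp only; omega)
  · rintro ⟨h1, h2, h3⟩
    constructor
    · intro x hx y hy e l
      rw [mem_stack] at hx hy
      rcases hx with hx | ⟨x, hx, rfl⟩ <;> rcases hy with hy | ⟨y, hy, rfl⟩
      · exact h1.1 x hx y hy e l
      · have := hA x hx
        have := hB y hy
        simp only at e
        omega
      · have := hA y hy
        have := hB x hx
        simp only at e
        omega
      · simp only at e l
        exact h2.1 x hx y hy (by omega) (by omega)
    · intro x hx y hy e l
      rw [mem_stack] at hx hy
      rcases hx with hx | ⟨x, hx, rfl⟩ <;> rcases hy with hy | ⟨y, hy, rfl⟩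
      · exact h1.2 x hx y hy e l
      · exact h3 x hx y hy e
      · have := hA y hy
        have := hB x hx
        simp only at l
        omega
      · simp only at e l
        exact h2.2 x hx y hy (by omega) (by omega)

/-- All rows of `A` come before those of `B`, so beyond its own lattice condition `A` enters only
through its content. -/
theorem lattice_stack_iff (hA : ∀ x ∈ A, x.1 < o.1) (hB : ∀ y ∈ B, 0 ≤ y.1) :
    Lattice (stack A B o) F ↔ Lattice A F ∧ ∀ r, 0 ≤ r → ∀ b,
      cnt A F (b + 1) + cnt {y ∈ B | y.1 ≤ r} (shift o F) (b + 1) ≤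
        cnt A F b + cnt {y ∈ B | y.1 < r} (shift o F) b := by
  have low : ∀ r, o.1 ≤ r → ({x ∈ A | x.1 ≤ r} : Diagram) = A := fun r hr =>
    filter_true_of_mem fun x hx => (hA x hx).le.trans hr
  have low' : ∀ r, o.1 ≤ r → ({x ∈ A | x.1 < r} : Diagram) = A := fun r hr =>
    filter_true_of_mem fun x hx => (hA x hx).trans_le hr
  have high : ∀ r, r < o.1 → ({y ∈ B | o.1 + y.1 ≤ r} : Diagram) = ∅ := fun r hr =>
    filter_false_of_mem fun y hy => by have := hB y hy; omega
  have high' : ∀ r, r < o.1 → ({y ∈ B | o.1 + y.1 < r} : Diagram) = ∅ := fun r hr =>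
    filter_false_of_mem fun y hy => by have := hB y hy; omega
  have cnt_empty : ∀ G b, cnt ∅ G b = 0 := fun G b => rfl
  have upper : ∀ r, r < o.1 → ∀ b, (cnt {x ∈ stack A B o | x.1 ≤ r} F (b + 1) ≤
      cnt {x ∈ stack A B o | x.1 < r} F b ↔
      cnt {x ∈ A | x.1 ≤ r} F (b + 1) ≤ cnt {x ∈ A | x.1 < r} F b) := fun r hr b => by
    rw [cnt_filter_stack hA hB, cnt_filter_stack hA hB]
    simp only [high r hr, high' r hr, cnt_empty, add_zero]
  have lower : ∀ r, 0 ≤ r → ∀ b, (cnt {x ∈ stack A B o | x.1 ≤ o.1 + r} F (b + 1) ≤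
      cnt {x ∈ stack A B o | x.1 < o.1 + r} F b ↔
      cnt A F (b + 1) + cnt {y ∈ B | y.1 ≤ r} (shift o F) (b + 1) ≤
        cnt A F b + cnt {y ∈ B | y.1 < r} (shift o F) b) := fun r hr b => by
    rw [cnt_filter_stack hA hB, cnt_filter_stack hA hB]
    simp only [low (o.1 + r) (by omega), low' (o.1 + r) (by omega), add_le_add_iff_left,
      add_lt_add_iff_left]
  constructor
  · intro h
    refine ⟨fun r b => ?_, fun r hr b => (lower r hr b).1 (h _ b)⟩
    by_cases hr : r < o.1
    · exact (upper r hr b).1 (h r b)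
    · have := (upper (o.1 - 1) (by omega) b).1 (h _ b)
      have e : ({x ∈ A | x.1 ≤ o.1 - 1} : Diagram) = A :=
        filter_true_of_mem fun x hx => by have := hA x hx; omega
      rw [e] at this
      rw [low r (by omega), low' r (by omega)]
      exact this.trans (cnt_mono (filter_subset _ _) _ _)
  · rintro ⟨h1, h2⟩ r b
    by_cases hr : r < o.1
    · exact (upper r hr b).2 (h1 r b)
    · have := (lower (r - o.1) (by omega) b).2 (h2 _ (by omega) b)
      rwa [add_sub_cancel] at this

theorem convex_stack (hA : ∀ x ∈ A, x.1 < o.1) (hB : ∀ y ∈ B, 0 ≤ y.1) (cA : Convex A)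
    (cB : Convex B) (h : ∀ x ∈ A, ∀ y ∈ B, x.2 ≤ o.2 + y.2 →
      (o.1 - 1, o.2 + y.2) ∈ A ∧ (0, x.2 - o.2) ∈ B) : Convex (stack A B o) := by
  intro x hx y hy i j h1 h2 h3 h4
  rw [mem_stack] at hx hy ⊢
  rcases hx with hx | ⟨x, hx, rfl⟩ <;> rcases hy with hy | ⟨y, hy, rfl⟩
  · exact .inl (cA x hx y hy i j h1 h2 h3 h4)
  · simp only at h2 h4
    obtain ⟨ha, hb⟩ := h x hx y hy (h3.trans h4)
    by_cases hi : i < o.1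
    · exact .inl (cA x hx _ ha i j h1 (by simp only; omega) h3 h4)
    · refine .inr ⟨(i - o.1, j - o.2), cB _ hb y hy _ _ ?_ ?_ ?_ ?_, by simp⟩ <;> omega
  · have := hA y hy
    have := hB x hx
    simp only at h1
    omega
  · simp only at h1 h2 h3 h4
    refine .inr ⟨(i - o.1, j - o.2), cB x hx y hy _ _ ?_ ?_ ?_ ?_, by simp⟩ <;> omega

end stack

/-- The last row of `D` is the row `R`, it has length `L` and begins in the column `s`. -/
structure HasFoot (D : Diagram) (R s : ℤ) (L : ℕ) : Prop where
  row_le : ∀ x ∈ D, x.1 ≤ R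
  le_col : ∀ x ∈ D, s ≤ x.2
  mem_iff : ∀ j, (R, j) ∈ D ↔ s ≤ j ∧ j < s + L

theorem lastRow_eq {D : Diagram} {R j : ℤ} (h : (R, j) ∈ D) (hR : ∀ x ∈ D, x.1 ≤ R) :
    lastRow D = R := by
  have : (D.image Prod.fst).max = R := by
    refine le_antisymm (Finset.max_le fun a ha => ?_) (Finset.le_max (mem_image.2 ⟨_, h, rfl⟩))
    obtain ⟨x, hx, rfl⟩ := mem_image.1 ha
    exact WithBot.coe_le_coe.2 (hR x hx)
  rw [lastRow, this]
  rfl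

theorem mem_lastRowBoxes {D : Diagram} {x : ℤ × ℤ} :
    x ∈ lastRowBoxes D ↔ x ∈ D ∧ x.1 = lastRow D := mem_filter

theorem lastRowStart_eq {D : Diagram} {s : ℤ} (h : (lastRow D, s) ∈ D)
    (hs : ∀ j, (lastRow D, j) ∈ D → s ≤ j) : lastRowStart D = s := by
  have : ((lastRowBoxes D).image Prod.snd).min = s := by
    refine le_antisymm (Finset.min_le (mem_image.2 ⟨_, mem_lastRowBoxes.2 ⟨h, rfl⟩, rfl⟩))
      (Finset.le_min fun a ha => ?_)
    obtain ⟨x, hx, rfl⟩ := mem_image.1 ha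
    obtain ⟨hx, e⟩ := mem_lastRowBoxes.1 hx
    refine WithTop.coe_le_coe.2 (hs _ ?_)
    rw [← e]
    exact hx
  rw [lastRowStart, this]
  rfl

theorem hasFoot_empty : HasFoot ∅ (lastRow ∅) (lastRowStart ∅) 0 :=
  ⟨by simp, by simp, by simp⟩

theorem Convex.hasFoot {D : Diagram} (hD : Convex D) :
    HasFoot D (lastRow D) (lastRowStart D) #(lastRowBoxes D) := by
  rcases D.eq_empty_or_nonempty with rfl | ne
  · exact hasFoot_empty
  obtain ⟨⟨R, j₀⟩, hc, hR⟩ := D.exists_max_image Prod.fst ne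
  simp only at hR
  have eR := lastRow_eq hc hR
  have ne' : (lastRowBoxes D).Nonempty := ⟨_, mem_lastRowBoxes.2 ⟨hc, eR.symm⟩⟩
  obtain ⟨⟨R', s⟩, hs, hmin⟩ := (lastRowBoxes D).exists_min_image Prod.snd ne'
  obtain ⟨⟨R'', t⟩, ht, hmax⟩ := (lastRowBoxes D).exists_max_image Prod.snd ne'
  rw [mem_lastRowBoxes] at hs ht
  obtain ⟨hs, e1⟩ := hs
  obtain ⟨ht, e2⟩ := ht
  simp only [eR] at e1 e2
  subst e1 e2
  have hmem : ∀ j, (R'', j) ∈ D → s ≤ j ∧ j ≤ t := fun j hj =>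
    ⟨hmin (R'', j) (mem_lastRowBoxes.2 ⟨hj, eR.symm⟩), hmax (R'', j) (mem_lastRowBoxes.2 ⟨hj, eR.symm⟩)⟩
  have es : lastRowStart D = s := lastRowStart_eq (eR.symm ▸ hs) fun j hj => (hmem j (eR ▸ hj)).1
  have hiff : ∀ j, (R'', j) ∈ D ↔ s ≤ j ∧ j ≤ t := fun j =>
    ⟨hmem j, fun h => hD _ hs _ ht _ _ le_rfl le_rfl h.1 h.2⟩
  have el : lastRowBoxes D = (Icc s t).image fun j => (R'', j) := by
    ext ⟨i, j⟩
    simp only [mem_lastRowBoxes, eR, mem_image, mem_Icc, Prod.mk.injEq]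
    constructor
    · rintro ⟨h, rfl⟩
      exact ⟨j, hmem j h, rfl, rfl⟩
    · rintro ⟨j, h, rfl, rfl⟩
      exact ⟨(hiff _).2 h, rfl⟩
  have ec : (#(lastRowBoxes D) : ℤ) = t + 1 - s := by
    rw [el, card_image_of_injective _ fun j j' e => (Prod.mk.inj e).2, Int.card_Icc]
    have := hmem s hs
    omega
  rw [es, eR]
  refine ⟨hR, fun x hx => ?_, fun j => ?_⟩
  · by_contra hlt
    have h1 := hR x hx
    have := hD x hx _ hs R'' x.2 h1 le_rfl le_rfl (by simp only; omega)
    have := hmem _ this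
    omega
  · rw [hiff, ec]
    omega

/-- The lattice condition at the last row bounds the number of `c + 1` by the number of `c` above
that row. Each step from `c` to `c + 1` thus loses the letters `c` of the last row, and the losses
add up. -/
theorem HasFoot.cnt_add_le {D : Diagram} {F : ℤ × ℤ → ℕ} {R s : ℤ} {L : ℕ} (hf : HasFoot D R s L)
    (hl : Lattice D F) (c : ℕ) : cnt D F c + #{x ∈ D | x.1 = R ∧ F x < c} ≤ cnt D F 0 := by
  induction c with
  | zero => simp
  | succ c ih =>
    have h1 := hl R c
    have e : ({x ∈ D | x.1 ≤ R} : Diagram) = D := filter_true_of_mem hf.row_le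
    rw [e] at h1
    have h2 : cnt {x ∈ D | x.1 < R} F c + #{x ∈ D | x.1 = R ∧ F x = c} ≤ cnt D F c := by
      unfold cnt
      rw [← card_union_of_disjoint]
      · refine card_le_card fun x hx => ?_
        simp only [mem_union, mem_filter] at hx ⊢
        tauto
      · refine disjoint_left.2 fun x hx hx' => ?_
        simp only [mem_filter] at hx hx'
        omega
    have h3 : #{x ∈ D | x.1 = R ∧ F x < c + 1} ≤
        #{x ∈ D | x.1 = R ∧ F x < c} + #{x ∈ D | x.1 = R ∧ F x = c} := by
      refine le_trans (card_le_card fun x hx => ?_) (card_union_le _ _)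
      simp only [mem_union, mem_filter] at hx ⊢
      have := hx.2.2
      rcases Nat.lt_succ_iff_lt_or_eq.1 this with h | h <;> tauto
    omega

/-- The first `t + 1` boxes of the last row have entries at most that of the box in position `t`.
This is the estimate behind the comparison of last rows. -/
theorem HasFoot.cnt_succ_add_le {D : Diagram} {F : ℤ × ℤ → ℕ} {R s : ℤ} {L : ℕ}
    (hf : HasFoot D R s L) (hF : Semi D F) (hl : Lattice D F) {t : ℕ} (ht : t < L) :
    cnt D F (F (R, s + t) + 1) + (t + 1) ≤ cnt D F 0 := by
  refine le_trans (Nat.add_le_add_left ?_ _) (hf.cnt_add_le hl _)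
  have hm : (R, s + (t : ℤ)) ∈ D := (hf.mem_iff _).2 (by omega)
  rw [← card_range (t + 1)]
  refine card_le_card_of_injOn (fun i => (R, s + (i : ℤ))) (fun i hi => ?_) fun i _ j _ e => ?_
  · simp only [coe_range, Set.mem_Iio, coe_filter, Set.mem_ofPred_eq, true_and] at hi ⊢
    have hi' : (R, s + (i : ℤ)) ∈ D := (hf.mem_iff _).2 (by omega)
    refine ⟨hi', Nat.lt_succ_iff.2 ?_⟩
    rcases (Nat.lt_succ_iff.1 hi).eq_or_lt with rfl | h
    · exact le_rfl
    · exact hF.1 _ hi' _ hm rfl (by simpa using h)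
  · simpa using e

/-- The offset of `lam / mu` in `glue lam mu D k`. -/
def glueOffset (mu : YoungDiagram) (D : Diagram) (k : ℕ) : ℤ × ℤ :=
  (lastRow D + 1, lastRowStart D - k - mu.rowLen 0)

theorem glue_eq_stack (lam mu : YoungDiagram) (D : Diagram) (k : ℕ) :
    glue lam mu D k = stack D (skewDiagram lam mu) (glueOffset mu D k) := by
  unfold glue stack glueOffset
  congr 2
  funext c
  exact Prod.ext rfl (by simp only; ring)

theorem row_nonneg {lam mu : YoungDiagram} : ∀ y ∈ skewDiagram lam mu, 0 ≤ y.1 := by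
  intro y hy
  obtain ⟨i, j, rfl, -⟩ := mem_skewDiagram.1 hy
  simp

theorem col_lt {lam mu : YoungDiagram} : ∀ y ∈ skewDiagram lam mu, y.2 < lam.rowLen 0 := by
  intro y hy
  obtain ⟨i, j, rfl, h, -⟩ := mem_skewDiagram.1 hy
  rw [YoungDiagram.mem_iff_lt_rowLen] at h
  have := lam.rowLen_anti 0 i (Nat.zero_le _)
  simp only
  omega

theorem HasFoot.row_lt_glueOffset {D : Diagram} {s : ℤ} {L : ℕ} (hf : HasFoot D (lastRow D) s L)
    (mu : YoungDiagram) (k : ℕ) : ∀ x ∈ D, x.1 < (glueOffset mu D k).1 :=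
  fun x hx => Int.lt_add_one_of_le (hf.row_le x hx)

/-- The overlap bound `hk` ensures that, in the columns where the two pieces can interact, the last
row of `D` and the first row of `lam / mu` are both present. -/
theorem convex_glue {D : Diagram} (hD : Convex D) {L : ℕ}
    (hf : HasFoot D (lastRow D) (lastRowStart D) L) {lam mu : YoungDiagram} {k : ℕ}
    (hk : (lam.rowLen 0 : ℤ) - mu.rowLen 0 - k ≤ L) : Convex (glue lam mu D k) := by
  rw [glue_eq_stack]
  refine convex_stack (hf.row_lt_glueOffset mu k) row_nonneg hD (convex_skewDiagram _ _) ?_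
  intro x hx y hy h
  have h1 := col_lt y hy
  have h2 := hf.le_col x hx
  simp only [glueOffset] at h ⊢
  refine ⟨?_, ?_⟩
  · rw [add_sub_cancel_right, hf.mem_iff]
    omega
  · rw [mem_skewDiagram]
    refine ⟨0, (x.2 - (lastRowStart D - k - mu.rowLen 0)).toNat, ?_, ?_, ?_⟩
    · refine Prod.ext rfl ?_
      simp only
      omega
    · rw [YoungDiagram.mem_iff_lt_rowLen]
      omega
    · rw [YoungDiagram.mem_iff_lt_rowLen]
      omega

/-- The lattice filling of the rotation of a straight shape: column by column, from top to bottom,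
the entries are `0, 1, 2, …`. -/
def rotatedFilling (ν : YoungDiagram) (x : ℤ × ℤ) : ℕ :=
  ν.colLen (-x.2).toNat - 1 - (-x.1).toNat

theorem mem_rotate {ν : YoungDiagram} {x : ℤ × ℤ} : x ∈ rotate (skewDiagram ν ⊥) ↔
    ∃ i j : ℕ, x = (-(i : ℤ), -(j : ℤ)) ∧ i < ν.colLen j := by
  rw [rotate, mem_image]
  constructor
  · rintro ⟨y, hy, rfl⟩
    obtain ⟨i, j, rfl, h⟩ := mem_straight.1 hy
    rw [← YoungDiagram.mem_iff_lt_rowLen, YoungDiagram.mem_iff_lt_colLen] at h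
    exact ⟨i, j, rfl, h⟩
  · rintro ⟨i, j, rfl, h⟩
    rw [← YoungDiagram.mem_iff_lt_colLen, YoungDiagram.mem_iff_lt_rowLen] at h
    exact ⟨_, mem_straight.2 ⟨i, j, rfl, h⟩, rfl⟩

theorem rotatedFilling_apply (ν : YoungDiagram) (i j : ℕ) :
    rotatedFilling ν (-(i : ℤ), -(j : ℤ)) = ν.colLen j - 1 - i := by
  simp [rotatedFilling]

theorem convex_rotate (ν : YoungDiagram) : Convex (rotate (skewDiagram ν ⊥)) := by
  intro x hx y hy i j h1 h2 h3 h4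
  rw [mem_rotate] at hx hy ⊢
  obtain ⟨i₁, j₁, rfl, h⟩ := hx
  obtain ⟨i₂, j₂, rfl, -⟩ := hy
  simp only at h1 h2 h3 h4
  refine ⟨(-i).toNat, (-j).toNat, Prod.ext ?_ ?_, ?_⟩
  · simp only; omega
  · simp only; omega
  · have := ν.colLen_anti (-j).toNat j₁ (by omega)
    omega

theorem semi_rotatedFilling (ν : YoungDiagram) :
    Semi (rotate (skewDiagram ν ⊥)) (rotatedFilling ν) := by
  constructor
  · intro x hx y hy h1 h2
    obtain ⟨i₁, j₁, rfl, h⟩ := mem_rotate.1 hx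
    obtain ⟨i₂, j₂, rfl, h'⟩ := mem_rotate.1 hy
    simp only at h1 h2
    have := ν.colLen_anti j₂ j₁ (by omega)
    rw [rotatedFilling_apply, rotatedFilling_apply]
    omega
  · intro x hx y hy h1 h2
    obtain ⟨i₁, j₁, rfl, h⟩ := mem_rotate.1 hx
    obtain ⟨i₂, j₂, rfl, h'⟩ := mem_rotate.1 hy
    simp only [neg_inj, Nat.cast_inj] at h1 h2
    subst h1
    rw [rotatedFilling_apply, rotatedFilling_apply]
    omega

/-- Every `b + 1` has a `b` directly above it. -/
theorem lattice_rotatedFilling (ν : YoungDiagram) :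
    Lattice (rotate (skewDiagram ν ⊥)) (rotatedFilling ν) := by
  intro r b
  refine card_le_card_of_injOn (fun x => (x.1 - 1, x.2)) (fun x hx => ?_) fun x _ y _ e => ?_
  · simp only [coe_filter, mem_filter, Set.mem_ofPred_eq] at hx ⊢
    obtain ⟨⟨hx, hr⟩, e⟩ := hx
    obtain ⟨i, j, rfl, h⟩ := mem_rotate.1 hx
    rw [rotatedFilling_apply] at e
    have e' : (-(i : ℤ) - 1, -(j : ℤ)) = (-((i + 1 : ℕ) : ℤ), -(j : ℤ)) := by
      push_cast
      exact Prod.ext (by simp only; ring) rfl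
    simp only at hr ⊢
    rw [e', rotatedFilling_apply]
    exact ⟨⟨mem_rotate.2 ⟨i + 1, j, rfl, by omega⟩, by omega⟩, by omega⟩
  · simp only [Prod.mk.injEq, sub_left_inj] at e
    exact Prod.ext e.1 e.2

theorem cnt_rotatedFilling (ν : YoungDiagram) (b : ℕ) :
    cnt (rotate (skewDiagram ν ⊥)) (rotatedFilling ν) b = ν.rowLen b := by
  rw [← card_range (ν.rowLen b)]
  symm
  refine card_bij (fun j _ => (-((ν.colLen j - 1 - b : ℕ) : ℤ), -(j : ℤ))) (fun j hj => ?_)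
    (fun j _ j' _ e => ?_) fun x hx => ?_
  · rw [mem_range, ← YoungDiagram.mem_iff_lt_rowLen, YoungDiagram.mem_iff_lt_colLen] at hj
    refine mem_filter.2 ⟨mem_rotate.2 ⟨_, j, rfl, by omega⟩, ?_⟩
    rw [rotatedFilling_apply]
    omega
  · simpa using (Prod.mk.inj e).2
  · obtain ⟨hx, e⟩ := mem_filter.1 hx
    obtain ⟨i, j, rfl, h⟩ := mem_rotate.1 hx
    rw [rotatedFilling_apply] at e
    have : b < ν.colLen j := by omega
    refine ⟨j, ?_, ?_⟩
    · rwa [mem_range, ← YoungDiagram.mem_iff_lt_rowLen, YoungDiagram.mem_iff_lt_colLen]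
    · refine Prod.ext ?_ rfl
      simp only
      omega

/-- The formula for the first column is restricted to nonempty diagrams, because `lastRowStart` of
the empty diagram is `0` by default and not `1`. -/
theorem hasFoot_rotate (ν : YoungDiagram) : HasFoot (rotate (skewDiagram ν ⊥))
    (lastRow (rotate (skewDiagram ν ⊥))) (lastRowStart (rotate (skewDiagram ν ⊥)))
    (ν.rowLen 0) ∧ ∀ x ∈ rotate (skewDiagram ν ⊥),
      lastRowStart (rotate (skewDiagram ν ⊥)) = 1 - (ν.rowLen 0 : ℤ) := by
  set E := rotate (skewDiagram ν ⊥) with hE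
  have mem0 : ∀ j : ℕ, (0, -(j : ℤ)) ∈ E ↔ j < ν.rowLen 0 := fun j => by
    rw [← YoungDiagram.mem_iff_lt_rowLen, YoungDiagram.mem_iff_lt_colLen, hE, mem_rotate]
    constructor
    · rintro ⟨i, j', e, h⟩
      obtain ⟨e1, e2⟩ := Prod.mk.inj e
      have : j = j' := by omega
      subst this
      omega
    · exact fun h => ⟨0, j, rfl, h⟩
  have colt : ∀ i j : ℕ, i < ν.colLen j → j < ν.rowLen 0 := fun i j h => by
    rw [← mem0]
    exact mem_rotate.2 ⟨0, j, rfl, by omega⟩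
  rcases Nat.eq_zero_or_pos (ν.rowLen 0) with h0 | hpos
  · have : E = ∅ := by
      refine eq_empty_of_forall_notMem fun x hx => ?_
      obtain ⟨i, j, rfl, h⟩ := mem_rotate.1 hx
      have := colt i j h
      omega
    rw [this, h0]
    exact ⟨hasFoot_empty, by simp⟩
  · have hR : ∀ x ∈ E, x.1 ≤ 0 := fun x hx => by
      obtain ⟨i, j, rfl, -⟩ := mem_rotate.1 hx
      simp
    have eR : lastRow E = 0 := lastRow_eq ((mem0 0).2 hpos) hR
    have hs : ∀ x ∈ E, 1 - (ν.rowLen 0 : ℤ) ≤ x.2 := fun x hx => by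
      obtain ⟨i, j, rfl, h⟩ := mem_rotate.1 hx
      have := colt i j h
      simp only
      omega
    have hm : ((0 : ℤ), 1 - (ν.rowLen 0 : ℤ)) ∈ E := by
      have := (mem0 (ν.rowLen 0 - 1)).2 (by omega)
      have e : -((ν.rowLen 0 - 1 : ℕ) : ℤ) = 1 - (ν.rowLen 0 : ℤ) := by omega
      rwa [e] at this
    have es : lastRowStart E = 1 - (ν.rowLen 0 : ℤ) :=
      lastRowStart_eq (eR.symm ▸ hm) fun j hj => hs _ hj
    refine ⟨?_, fun _ _ => es⟩
    rw [eR, es]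
    refine ⟨hR, hs, fun j => ⟨fun hj => ⟨hs _ hj, ?_⟩, fun hj => ?_⟩⟩
    · obtain ⟨i, j', e, -⟩ := mem_rotate.1 hj
      have := (Prod.mk.inj e).2
      omega
    · have := (mem0 (-j).toNat).2 (by omega)
      have e : -((-j).toNat : ℤ) = j := by omega
      rwa [e] at this

end FatStaircase
end

/-! ### Replacement of the upper part, and the resulting injection. -/

noncomputable section
namespace FatStaircase
open Finset

theorem count_flatMap_replicate (g : ℕ → ℕ) (n x : ℕ) :
    ((List.range n).reverse.flatMap fun i => List.replicate (g i) (i + 1)).count x =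
      if 1 ≤ x ∧ x ≤ n then g (x - 1) else 0 := by
  induction n with
  | zero => simp; omega
  | succ n ih =>
    rw [List.range_succ, List.reverse_append, List.reverse_singleton, List.singleton_append,
      List.flatMap_cons, List.count_append, ih, List.count_replicate]
    by_cases h : x = n + 1
    · subst h
      simp
    · have : ¬ (n + 1 = x) := fun e => h e.symm
      simp only [beq_iff_eq, this, if_false, zero_add]
      refine if_congr ?_ rfl rfl
      omega

/-- Both lists are sorted and have the same multiplicities; a zero entry of `alphaOf ν` just
contributes no row. Hence `Delta (alphaOf ν)` is the rotation of `ν`. -/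
theorem deltaRows_alphaOf (ν : YoungDiagram) : deltaRows (alphaOf ν) = ν.rowLens := by
  have mem : ∀ x ∈ ν.rowLens, 1 ≤ x ∧ x ≤ ν.rowLen 0 := fun x hx => by
    obtain ⟨i, hi, rfl⟩ := List.mem_map.1 hx
    rw [List.mem_range, ← YoungDiagram.mem_iff_lt_colLen, YoungDiagram.mem_iff_lt_rowLen] at hi
    exact ⟨hi, ν.rowLen_anti _ _ (Nat.zero_le i)⟩
  have len : (alphaOf ν).length = ν.rowLen 0 := by simp [alphaOf]
  refine List.Perm.eq_of_sortedGE (deltaRows_sorted _) ν.rowLens_sorted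
    (List.perm_iff_count.2 fun x => ?_)
  rw [deltaRows, count_flatMap_replicate, len]
  split_ifs with h
  · have hx : x - 1 < ν.rowLen 0 := by omega
    rw [List.getD_eq_getElem _ _ (by omega)]
    simp only [alphaOf, List.getElem_map, List.getElem_range]
    rw [Nat.sub_add_cancel h.1]
  · rw [eq_comm, List.count_eq_zero]
    exact fun hx => h (mem x hx)

theorem delta_alphaOf (ν : YoungDiagram) : delta (alphaOf ν) = ν := by
  have : ∀ l (hl : List.SortedGE l), l = ν.rowLens → YoungDiagram.ofRowLens l hl = ν := by
    rintro _ hl rfl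
    exact YoungDiagram.ofRowLens_to_rowLens_eq_self
  exact this _ _ (deltaRows_alphaOf ν)

theorem shape_congr {D D' : Diagram} {F F' : ℤ × ℤ → ℕ} (h : ∀ b, cnt D F b = cnt D' F' b) :
    shape D F = shape D' F' :=
  congrArg partitionOf (funext h)

/-- Replacement of the upper part of a filling, above the row `o'.1`, by the filling `G`. -/
def replaceTop (G F : ℤ × ℤ → ℕ) (o o' x : ℤ × ℤ) : ℕ :=
  if x.1 < o'.1 then G x else F (o.1 + (x.1 - o'.1), o.2 + (x.2 - o'.2))

theorem replaceTop_of_lt {G F : ℤ × ℤ → ℕ} {o o' x : ℤ × ℤ} (h : x.1 < o'.1) :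
    replaceTop G F o o' x = G x := if_pos h

theorem shift_replaceTop {G F : ℤ × ℤ → ℕ} {o o' y : ℤ × ℤ} (h : 0 ≤ y.1) :
    shift o' (replaceTop G F o o') y = shift o F y := by
  have : ¬ (o'.1 + y.1 < o'.1) := by omega
  simp [shift, replaceTop, this]

/-- The last row of the rotated shape is at least as long as that of `D`, so the overlap bound
carries over to it. -/
theorem rowLen_zero_ge {D : Diagram} {F : ℤ × ℤ → ℕ} {R s : ℤ} {L : ℕ} (hf : HasFoot D R s L)
    (hF : Semi D F) (hl : Lattice D F) : L ≤ (shape D F).rowLen 0 := by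
  rw [hl.rowLen_shape]
  rcases L with - | L
  · exact Nat.zero_le _
  · have := hf.cnt_succ_add_le hF hl (Nat.lt_succ_self L)
    omega

/-- A filling of `D` may be replaced by the lattice filling of the rotated shape with the same
content. -/
theorem replaceTop_mem {D : Diagram} {L : ℕ}
    (hf : HasFoot D (lastRow D) (lastRowStart D) L) {lam mu : YoungDiagram} {k : ℕ}
    (hk : (lam.rowLen 0 : ℤ) - mu.rowLen 0 - k ≤ L) {F : ℤ × ℤ → ℕ}
    (hF : Semi (glue lam mu D k) F) (hl : Lattice (glue lam mu D k) F) {ν : YoungDiagram}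
    (hν : ∀ b, ν.rowLen b = cnt D F b) :
    let E := rotate (skewDiagram ν ⊥)
    let W := replaceTop (rotatedFilling ν) F (glueOffset mu D k) (glueOffset mu E k)
    Semi (glue lam mu E k) W ∧ Lattice (glue lam mu E k) W ∧
      ∀ b, cnt (glue lam mu E k) W b = cnt (glue lam mu D k) F b := by
  intro E W
  obtain ⟨hE, hs⟩ := hasFoot_rotate ν
  have aD := hf.row_lt_glueOffset mu k
  have aE := hE.row_lt_glueOffset mu k
  have hB := row_nonneg (lam := lam) (mu := mu)
  rw [glue_eq_stack] at hF hl ⊢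
  rw [glue_eq_stack lam mu D]
  rw [semi_stack_iff aD hB] at hF
  rw [lattice_stack_iff aD hB] at hl
  rw [semi_stack_iff aE hB, lattice_stack_iff aE hB]
  have eE : ∀ x ∈ E, rotatedFilling ν x = W x := fun x hx => (replaceTop_of_lt (aE x hx)).symm
  have eB : ∀ y ∈ skewDiagram lam mu,
      shift (glueOffset mu D k) F y = shift (glueOffset mu E k) W y :=
    fun y hy => (shift_replaceTop (hB y hy)).symm
  have cE : ∀ b, cnt E W b = cnt D F b := fun b => by
    rw [← cnt_congr eE, cnt_rotatedFilling, hν]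
  refine ⟨⟨(semi_rotatedFilling ν).congr eE, hF.2.1.congr eB, fun x hx y hy e => ?_⟩,
    ⟨(lattice_rotatedFilling ν).congr eE, fun r hr b => ?_⟩, fun b => ?_⟩
  · rw [← eE x hx, ← eB y hy]
    have es := hs x hx
    have h1 := col_lt y hy
    have h2 := hE.le_col x hx
    simp only [glueOffset] at e
    -- The column of `y`, counted from the start of the last row. This position is the same in both
    -- glued diagrams.
    obtain ⟨t, ht⟩ : ∃ t : ℕ, (t : ℤ) = y.2 - k - mu.rowLen 0 :=
      ⟨(y.2 - k - mu.rowLen 0).toNat, by omega⟩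
    have htL : t < L := by omega
    have hm : (lastRow D, lastRowStart D + (t : ℤ)) ∈ D := (hf.mem_iff _).2 (by omega)
    have hlt := hF.2.2 _ hm y hy (by simp only [glueOffset]; omega)
    refine lt_of_le_of_lt ?_ hlt
    have hb := hf.cnt_succ_add_le hF.1 hl.1 htL
    rw [← hν, ← hν] at hb
    set a := F (lastRow D, lastRowStart D + (t : ℤ))
    obtain ⟨i, j, rfl, -⟩ := mem_rotate.1 hx
    rw [rotatedFilling_apply]
    simp only at e h2
    -- Here `j = ν.rowLen 0 - 1 - t`, so `hb` says that row `a + 1` of `ν` does not reach column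
    -- `j`. The entries of that column in the rotated filling are then at most `a`.
    have : ν.colLen j ≤ a + 1 := by
      rw [← not_lt, ← YoungDiagram.mem_iff_lt_colLen, YoungDiagram.mem_iff_lt_rowLen]
      omega
    omega
  · rw [cE, cE, ← cnt_congr fun y hy => eB y (mem_of_mem_filter y hy),
      ← cnt_congr fun y hy => eB y (mem_of_mem_filter y hy)]
    exact hl.2 r hr b
  · rw [cnt_stack aE hB, cnt_stack aD hB, cE, ← cnt_congr eB]

-- On the fibre over `T` the upper part is fixed and the replacement keeps the lower part, so it is
-- injective; it also preserves the content.
open Classical in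
theorem card_le_card_glue {D : Diagram} {L : ℕ}
    (hf : HasFoot D (lastRow D) (lastRowStart D) L) {lam mu : YoungDiagram} {k : ℕ}
    (hk : (lam.rowLen 0 : ℤ) - mu.rowLen 0 - k ≤ L) {T : D → ℕ} (hT : T ∈ latticeFillings D)
    (σ : YoungDiagram) :
    #{V ∈ latticeFillings (glue lam mu D k) |
      shape (glue lam mu D k) (extend V) = σ ∧ restr D (extend V) = T} ≤
    #{W ∈ latticeFillings (glue lam mu (rotate (skewDiagram (shape D (extend T)) ⊥)) k) |
      shape (glue lam mu (rotate (skewDiagram (shape D (extend T)) ⊥)) k) (extend W) = σ} := by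
  set ν := shape D (extend T) with hν
  set E := rotate (skewDiagram ν ⊥) with hE
  have key : ∀ V ∈ latticeFillings (glue lam mu D k), restr D (extend V) = T →
      ∀ b, ν.rowLen b = cnt D (extend V) b := fun V hV e b => by
    rw [hν, (mem_latticeFillings.1 hT).2.rowLen_shape, ← e]
    exact cnt_congr (extend_restr _) b
  refine card_le_card_of_injOn (fun V => restr _ (replaceTop (rotatedFilling ν) (extend V)
    (glueOffset mu D k) (glueOffset mu E k))) (fun V hV => ?_) fun V hV V' hV' e => ?_
  · simp only [coe_filter, Set.mem_ofPred_eq] at hV ⊢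
    obtain ⟨hV, e1, e2⟩ := hV
    have hV' := mem_latticeFillings.1 hV
    obtain ⟨h1, h2, h3⟩ := replaceTop_mem hf hk hV'.1 hV'.2 (key V hV e2)
    refine ⟨restr_mem_latticeFillings.2 ⟨h1, h2⟩, ?_⟩
    rw [← e1]
    refine shape_congr fun b => ?_
    rw [cnt_congr (extend_restr _)]
    exact h3 b
  · simp only [coe_filter, Set.mem_ofPred_eq] at hV hV'
    have eT : restr D (extend V) = restr D (extend V') := hV.2.2.trans hV'.2.2.symm
    funext ⟨x, hx⟩
    rw [← extend_apply V hx, ← extend_apply V' hx]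
    rw [glue_eq_stack] at hx
    rcases mem_stack.1 hx with hx | ⟨y, hy, rfl⟩
    · exact congrFun eT ⟨x, hx⟩
    · have hm : ((glueOffset mu E k).1 + y.1, (glueOffset mu E k).2 + y.2) ∈ glue lam mu E k := by
        rw [glue_eq_stack]
        exact mem_stack_right hy
      have := congrFun e ⟨_, hm⟩
      simp only [restr] at this
      have h0 := row_nonneg y hy
      have l := shift_replaceTop (G := rotatedFilling ν) (F := extend V)
        (o := glueOffset mu D k) (o' := glueOffset mu E k) h0
      have l' := shift_replaceTop (G := rotatedFilling ν) (F := extend V')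
        (o := glueOffset mu D k) (o' := glueOffset mu E k) h0
      exact l.symm.trans (this.trans l')

theorem restr_mem_of_glue {D : Diagram} {L : ℕ} (hf : HasFoot D (lastRow D) (lastRowStart D) L)
    {lam mu : YoungDiagram} {k : ℕ} {V : glue lam mu D k → ℕ}
    (hV : V ∈ latticeFillings (glue lam mu D k)) :
    restr D (extend V) ∈ latticeFillings D := by
  obtain ⟨h1, h2⟩ := mem_latticeFillings.1 hV
  rw [restr_mem_latticeFillings]
  generalize extend V = F at h1 h2
  rw [glue_eq_stack] at h1 h2
  exact ⟨((semi_stack_iff (hf.row_lt_glueOffset mu k) row_nonneg).1 h1).1,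
    ((lattice_stack_iff (hf.row_lt_glueOffset mu k) row_nonneg).1 h2).1⟩

open Classical in
theorem sum_single_apply {ι : Type*} (s : Finset ι) (p : ι → YoungDiagram) (σ : YoungDiagram) :
    (∑ T ∈ s, Finsupp.single (p T) (1 : ℤ)) σ = #{T ∈ s | p T = σ} := by
  rw [Finsupp.finsetSum_apply, card_filter, Nat.cast_sum]
  refine sum_congr rfl fun T _ => ?_
  rw [Finsupp.single_apply]
  split_ifs <;> rfl

/-- The difference is Schur-positive for each skew diagram `ρ / κ`, whether or not it is a sum of fat
staircases: the last row of the lattice filling of the rotated shape is entrywise at most the last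
row of each lattice filling of `ρ / κ` with the same content. -/
theorem schurPositive_sum_sub (ρ κ lam mu : YoungDiagram) (k : ℕ)
    (hk : (lam.rowLen 0 : ℤ) - mu.rowLen 0 - k ≤ #(lastRowBoxes (skewDiagram ρ κ))) :
    SchurPositive ((∑ ν ∈ (lrCoeff ρ κ).support,
      lrCoeff ρ κ ν • skewSchur (glue lam mu (Delta (alphaOf ν)) k)) -
        skewSchur (glue lam mu (skewDiagram ρ κ) k)) := by
  classical
  set D := skewDiagram ρ κ with hDdef
  have hD : Convex D := convex_skewDiagram ρ κ
  have hf := hD.hasFoot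
  let E : (D → ℕ) → Diagram := fun T =>
    glue lam mu (rotate (skewDiagram (shape D (extend T)) ⊥)) k
  have hE : ∀ T ∈ latticeFillings D, Convex (E T) := fun T hT => by
    obtain ⟨h1, h2⟩ := mem_latticeFillings.1 hT
    refine convex_glue (convex_rotate _) (hasFoot_rotate _).1 (hk.trans ?_)
    exact_mod_cast rowLen_zero_ge hf h1 h2
  -- The coefficient `lrCoeff ρ κ ν` is spread over the lattice fillings `T` of `D` of content `ν`,
  -- so the sum runs over pairs of such a `T` and a lattice filling of the diagram glued to its
  -- rotated shape.
  have e1 : (∑ ν ∈ (lrCoeff ρ κ).support,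
      lrCoeff ρ κ ν • skewSchur (glue lam mu (Delta (alphaOf ν)) k)) =
      ∑ p ∈ (latticeFillings D).sigma fun T => latticeFillings (E T),
        schur (shape (E p.1) (extend p.2)) := by
    rw [sum_sigma]
    refine Eq.trans ?_ (sum_congr rfl fun T hT => skewSchur_eq_sum (hE T hT))
    have := sum_single_sum (latticeFillings D) (fun T => shape D (extend T))
      fun ν => skewSchur (glue lam mu (Delta (alphaOf ν)) k)
    rw [← lrCoeff_eq] at this
    simp only [Delta, delta_alphaOf] at this ⊢
    exact this
  rw [e1, skewSchur_eq_sum (convex_glue hD hf hk)]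
  refine ⟨_, (hasSchurExpansion_sum _ _).sub (hasSchurExpansion_sum _ _), fun σ => ?_⟩
  rw [Finsupp.sub_apply, sum_single_apply, sum_single_apply, sub_nonneg, Nat.cast_le]
  -- The fillings of the glued diagram are sorted by their restriction to `D`, to be compared with
  -- the pairs one `T` at a time.
  rw [card_eq_sum_card_fiberwise (f := fun V => restr D (extend V)) (t := latticeFillings D)
    fun V hV => restr_mem_of_glue hf (mem_filter.1 hV).1]
  have e2 : #{p ∈ (latticeFillings D).sigma fun T => latticeFillings (E T) |
      shape (E p.1) (extend p.2) = σ} =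
      ∑ T ∈ latticeFillings D, #{W ∈ latticeFillings (E T) | shape (E T) (extend W) = σ} := by
    rw [← card_sigma]
    congr 1
    ext ⟨T, W⟩
    simp only [mem_filter, mem_sigma, and_assoc]
  rw [e2]
  refine sum_le_sum fun T hT => ?_
  rw [filter_filter]
  exact card_le_card_glue hf hk hT σ

end FatStaircase
end

theorem theorem5p1 (ρ κ : YoungDiagram) (hκ : κ ≤ ρ)
    (hD : FatStaircase.IsSumOfFatStaircases ρ κ)
    (lam mu : YoungDiagram) (hmu : mu ≤ lam) (k : ℕ)
    -- the overlap `lam_1 - mu_1 - k` is at most the length of the last row of `ρ / κ`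
    (hk : (lam.rowLen 0 : ℤ) - mu.rowLen 0 - k ≤
      (FatStaircase.lastRowBoxes (FatStaircase.skewDiagram ρ κ)).card) :
    FatStaircase.SchurPositive
      ((∑ ν ∈ (FatStaircase.lrCoeff ρ κ).support, FatStaircase.lrCoeff ρ κ ν •
          FatStaircase.skewSchur
            (FatStaircase.glue lam mu (FatStaircase.Delta (FatStaircase.alphaOf ν)) k)) -
        FatStaircase.skewSchur
          (FatStaircase.glue lam mu (FatStaircase.skewDiagram ρ κ) k)) := by
  exact FatStaircase.schurPositive_sum_sub ρ κ lam mu k hk
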